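/- Throughout, rings and algebras are associative but need not have a unity, and $\mathbb{K}$ is a commutative ring with unity. A $\mathbb{K}$-algebra with enough idempotents is a pair $(R,\{e_i\}_{i\in I})$ where $R$ is a $\mathbb{K}$-algebra and the $e_i$ are orthogonal idempotents with $R=\bigoplus_i e_iR=\bigoplus_i Re_i$. It is *basic* if every $e_jRe_i$ has finite length over $\mathbb{K}$, every $e_i$ is primitive, and $Re_i\not\simeq Re_j$ as left modules whenever $e_i\neq e_j$. It is *support finite* if for every $i$ the sets $\{j : e_jRe_i\neq 0\}$ and $\{j : e_iRe_j\neq 0\}$ are finite. $\mathrm{Mod}(R)$ is the category of unitary left $R$-modules ($RN=N$), and $\mathrm{mod}(R)$ its full subcategory of finitely generated modules. $\mathrm{pd}(N)\in\{0,1,2,\dots,\infty\}$ is the least length of a projective resolution of $N$ in $\mathrm{Mod}(R)$ (so $\mathrm{pd}(0)=0$). $\mathcal P_R^{<\infty}$ is the class of all $N\in\mathrm{mod}(R)$ with $\mathrm{pd}(N)<\infty$, and $$\mathrm{gl.dim.}(R)=\sup\{\mathrm{pd}(N): N\in\mathrm{mod}(R)\},\qquad \mathrm{fin.dim.}(R)=\sup\{\mathrm{pd}(N):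 N\in\mathcal P_R^{<\infty}\}$$ are the small global and the small finitistic dimension of $R$. **Theorem.** Let $(U,\{e_i\}_{i\in I})$ and $(T,\{f_j\}_{j\in J})$ be basic $\mathbb{K}$-algebras with enough idempotents, and let $M$ be a $U$-$T$-bimodule, unitary on both sides, on which $\mathbb{K}$ acts centrally, such that every $e_iMf_j$ has finite length over $\mathbb{K}$. Let $\Lambda=\left[\begin{smallmatrix} T&0\\ M&U\end{smallmatrix}\right]$ be the lower triangular matrix algebra, with the idempotents $\left[\begin{smallmatrix} 0&0\\ 0&e_i\end{smallmatrix}\right]$ $(i\in I)$ and $\left[\begin{smallmatrix} f_j&0\\ 0&0\end{smallmatrix}\right]$ $(j\in J)$, and assume that $\Lambda$ is support finite with respect to them. For $Y\in\mathrm{Mod}(T)$, $X\in\mathrm{Mod}(U)$ and a homomorphism of $U$-modules $\varphi:M\otimes_TY\to X$, let $(Y,\varphi,X)$ denote the unitary $\Lambda$-module of columns $\left[\begin{smallmatrix} y\\ x\end{smallmatrix}\right]$ ($y\in Y$, $x\in X$) with $\left[\begin{smallmatrix} t&0\\ m&u\end{smallmatrix}\right]\left[\begin{smallmatrix} y\\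 x\end{smallmatrix}\right]=\left[\begin{smallmatrix} ty\\ \varphi(m\otimes y)+ux\end{smallmatrix}\right]$. (a) If $\mathrm{pd}(Mf_j)<\infty$ for all $j\in J$, where $Mf_j$ is regarded as a left $U$-module, then for every triple $L=(Y,\varphi,X)$ as above, $$L\in\mathcal P_\Lambda^{<\infty}\iff Y\in\mathcal P_T^{<\infty}\ \text{ and }\ X\in\mathcal P_U^{<\infty}.$$ (b) If $m:=\sup_{j\in J}\mathrm{pd}(Mf_j)<\infty$, then $$\max\{\mathrm{gl.dim.}(U)-m,\ \mathrm{gl.dim.}(T)\}\le \mathrm{gl.dim.}(\Lambda)\le\max\{\mathrm{gl.dim.}(U),\ \mathrm{gl.dim.}(T)+1+m\},$$ $$\max\{\mathrm{fin.dim.}(U)-m,\ \mathrm{fin.dim.}(T)\}\le \mathrm{fin.dim.}(\Lambda)\le\max\{\mathrm{fin.dim.}(U),\ \mathrm{fin.dim.}(T)+1+m\}.$$ Here the dimensions may be $\infty$, with $\infty-m=\infty$ and $\infty+1+m=\infty$. -/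

import Mathlib

open scoped TensorProduct

universe u w

set_option linter.unusedSectionVars false

namespace TriAlg

/-! ### Modules over rings without unity -/

/-- The axioms of a left module over an associative ring `R` that need not have a unity.
A right `T`-module is a left module over `Tᵐᵒᵖ`, with `x * t = MulOpposite.op t • x`. -/
class IsNUModule (R N : Type*) [NonUnitalRing R] [AddCommGroup N] [SMul R N] : Prop where
  smul_add : ∀ (r : R) (x y : N), r • (x + y) = r • x + r • y
  add_smul : ∀ (r s : R) (x : N), (r + s) • x = r • x + s • x
  mul_smul : ∀ (r s : R) (x : N), (r * s) • x = r • (s • x)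

/-- `R N = N`: every element of `N` is a finite sum of elements `r • x`. -/
def IsUnitary (R N : Type*) [AddCommGroup N] [SMul R N] : Prop :=
  ∀ x : N, x ∈ AddSubgroup.closure (Set.range fun p : R × N => p.1 • p.2)

section basic

variable {R N : Type*} [NonUnitalRing R] [AddCommGroup N] [SMul R N] [IsNUModule R N]

/-- The action of one ring element, as an additive map. -/
def actHom (r : R) : N →+ N := AddMonoidHom.mk' (fun x => r • x) (IsNUModule.smul_add r)

@[simp] theorem actHom_apply (r : R) (x : N) : actHom r x = r • x := rfl

theorem nu_smul_zero (r : R) : r • (0 : N) = 0 := (actHom (N := N) r).map_zero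

theorem nu_zero_smul (x : N) : (0 : R) • x = 0 := by
  have h := IsNUModule.add_smul (0 : R) 0 x
  rw [add_zero] at h
  exact left_eq_add.mp h

theorem nu_smul_neg (r : R) (x : N) : r • (-x) = -(r • x) := (actHom (N := N) r).map_neg x

end basic

/-- The regular left module. -/
instance instLeftRegular (R : Type*) [NonUnitalRing R] : IsNUModule R R where
  smul_add := mul_add
  add_smul := add_mul
  mul_smul := mul_assoc

/-- The regular right module. -/
instance instRightRegular (R : Type*) [NonUnitalRing R] : IsNUModule Rᵐᵒᵖ R where
  smul_add r x y := add_mul x y r.unop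
  add_smul r s x := mul_add x r.unop s.unop
  mul_smul r s x := (mul_assoc x s.unop r.unop).symm

/-- Homomorphisms of left modules over a ring that need not have a unity. -/
structure NUHom (R N N' : Type*) [AddCommGroup N] [SMul R N] [AddCommGroup N'] [SMul R N']
    extends N →+ N' where
  map_smul' : ∀ (r : R) (x : N), toFun (r • x) = r • toFun x

instance {R N N' : Type*} [AddCommGroup N] [SMul R N] [AddCommGroup N'] [SMul R N'] :
    FunLike (NUHom R N N') N N' where
  coe f := f.toFun
  coe_injective f g h := by
    cases f; cases g; congr; exact DFunLike.coe_injective h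

/-- An object of `Mod(R)`, the category of unitary left `R`-modules. -/
structure UMod (R : Type u) [NonUnitalRing R] where
  carrier : Type u
  [grp : AddCommGroup carrier]
  [act : SMul R carrier]
  [isMod : IsNUModule R carrier]
  unitary : IsUnitary R carrier

attribute [instance] UMod.grp UMod.act UMod.isMod

namespace UMod

variable {R : Type u} [NonUnitalRing R]

/-- `N` is finitely generated, i.e. `N ∈ mod(R)`: `N = R a₁ + ⋯ + R aₙ` for some `aᵢ ∈ N`. -/
def FG (N : UMod R) : Prop :=
  ∃ s : Finset N.carrier, ∀ x : N.carrier,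
    x ∈ AddSubgroup.closure {y | ∃ r : R, ∃ a ∈ s, y = r • a}

/-- `P` is a projective object of `Mod(R)` (epimorphisms in `Mod(R)` are the surjections). -/
def IsProjective (P : UMod R) : Prop :=
  ∀ (A B : UMod R) (g : NUHom R A.carrier B.carrier) (h : NUHom R P.carrier B.carrier),
    Function.Surjective g → ∃ k : NUHom R P.carrier A.carrier, ∀ x, g (k x) = h x

/-- `N` has a projective resolution `0 → Pₙ → ⋯ → P₀ → N → 0` in `Mod(R)`, cut into short exact
sequences. -/
def HasProjRes : ℕ → UMod R → Prop
  | 0, N => N.IsProjective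
  | n + 1, N => ∃ (Q P : UMod R) (i : NUHom R Q.carrier P.carrier)
      (p : NUHom R P.carrier N.carrier),
      Function.Injective i ∧ Function.Surjective p ∧ (∀ x, p x = 0 ↔ ∃ y, i y = x) ∧
      P.IsProjective ∧ HasProjRes n Q

/-- The projective dimension of `N` in `Mod(R)`: the least length of a projective resolution,
`⊤` if there is no finite one. The zero module has projective dimension `0`. -/
noncomputable def pd (N : UMod R) : ℕ∞ :=
  sInf {d : ℕ∞ | ∃ n : ℕ, d = n ∧ HasProjRes n N}

/-- The class of the finitely generated unitary modules of finite projective dimension. -/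
def FinPD (N : UMod R) : Prop := N.FG ∧ N.pd < ⊤

end UMod

/-- The small global dimension: the supremum of `pd` over the finitely generated modules. -/
noncomputable def glDim (R : Type u) [NonUnitalRing R] : ℕ∞ :=
  ⨆ (N : UMod.{u} R) (_ : N.FG), N.pd

/-- The small finitistic dimension: the supremum of `pd` over the finitely generated modules of
finite projective dimension. -/
noncomputable def finDim (R : Type u) [NonUnitalRing R] : ℕ∞ :=
  ⨆ (N : UMod.{u} R) (_ : N.FinPD), N.pd

/-! ### Peirce pieces of bimodules -/

section corners

variable {U T M : Type*} [NonUnitalRing U] [NonUnitalRing T] [AddCommGroup M]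
  [SMul U M] [IsNUModule U M] [SMul Tᵐᵒᵖ M] [IsNUModule Tᵐᵒᵖ M]

/-- The additive group `M f` for `f ∈ T`. -/
def rightCorner (T M : Type*) [NonUnitalRing T] [AddCommGroup M] [SMul Tᵐᵒᵖ M]
    [IsNUModule Tᵐᵒᵖ M] (f : T) : AddSubgroup M :=
  (actHom (N := M) (MulOpposite.op f)).range

variable [SMulCommClass U Tᵐᵒᵖ M]

instance instSMulRightCorner (f : T) : SMul U (rightCorner T M f) where
  smul r x := ⟨r • x.1, by
    obtain ⟨_, m, rfl⟩ := x
    exact ⟨r • m, (smul_comm r (MulOpposite.op f) m).symm⟩⟩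

@[simp] theorem rightCorner_coe_smul (f : T) (r : U) (x : rightCorner T M f) :
    ((r • x : rightCorner T M f) : M) = r • (x : M) := rfl

instance instModRightCorner (f : T) : IsNUModule U (rightCorner T M f) where
  smul_add r x y := Subtype.ext (IsNUModule.smul_add r x.1 y.1)
  add_smul r s x := Subtype.ext (IsNUModule.add_smul r s x.1)
  mul_smul r s x := Subtype.ext (IsNUModule.mul_smul r s x.1)

theorem isUnitary_rightCorner (h : IsUnitary U M) (f : T) :
    IsUnitary U (rightCorner T M f) := by
  rintro ⟨_, m, rfl⟩
  let φ : M →+ rightCorner T M f := (actHom (N := M) (MulOpposite.op f)).rangeRestrict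
  change φ m ∈ _
  have hm := AddSubgroup.mem_map_of_mem φ (h m)
  rw [AddMonoidHom.map_closure] at hm
  refine AddSubgroup.closure_mono ?_ hm
  rintro _ ⟨_, ⟨⟨r, x⟩, rfl⟩, rfl⟩
  exact ⟨(r, φ x), Subtype.ext (smul_comm r (MulOpposite.op f) x)⟩

/-- The `K`-module `e M f`, for `e ∈ U` and `f ∈ T`. -/
def corner (K : Type*) [CommRing K] [Module K M] [SMulCommClass K U M]
    [SMulCommClass K Tᵐᵒᵖ M] (e : U) (f : T) : Submodule K M where
  carrier := {x | ∃ m : M, x = e • (MulOpposite.op f • m)}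
  zero_mem' := ⟨0, by rw [nu_smul_zero, nu_smul_zero]⟩
  add_mem' := by
    rintro _ _ ⟨m, rfl⟩ ⟨m', rfl⟩
    exact ⟨m + m', by rw [IsNUModule.smul_add, IsNUModule.smul_add]⟩
  smul_mem' := by
    rintro k _ ⟨m, rfl⟩
    exact ⟨k • m, by rw [smul_comm k e, smul_comm k (MulOpposite.op f)]⟩

end corners

/-! ### Algebras with enough idempotents -/

/-- `e` is a primitive idempotent: it is not zero, and not a sum of two nonzero orthogonal
idempotents. -/
def IsPrimitive {R : Type*} [NonUnitalRing R] (e : R) : Prop :=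
  e * e = e ∧ e ≠ 0 ∧
    ∀ a b : R, a * a = a → b * b = b → a * b = 0 → b * a = 0 → e = a + b → a = 0 ∨ b = 0

/-- `(R, {eᵢ})` is an algebra with enough idempotents: the `eᵢ` are orthogonal idempotents and
`R = ⨁ eᵢ R = ⨁ R eᵢ` (internal direct sums of subgroups). -/
structure IsWEI {R I : Type*} [NonUnitalRing R] (e : I → R) : Prop where
  idem : ∀ i, e i * e i = e i
  orth : ∀ i j, i ≠ j → e i * e j = 0
  left_indep : iSupIndep fun i => (AddMonoidHom.mulLeft (e i)).range
  left_span : ⨆ i, (AddMonoidHom.mulLeft (e i)).range = ⊤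
  right_indep : iSupIndep fun i => (AddMonoidHom.mulRight (e i)).range
  right_span : ⨆ i, (AddMonoidHom.mulRight (e i)).range = ⊤

/-- A basic `K`-algebra with enough idempotents: every `eⱼ R eᵢ` has finite length over `K`, every
`eᵢ` is primitive, and the left modules `R eᵢ` are pairwise non-isomorphic. -/
structure IsBasicWEI (K : Type*) {R I : Type*} [CommRing K] [NonUnitalRing R] [Module K R]
    [IsScalarTower K R R] [SMulCommClass K R R] (e : I → R) : Prop extends IsWEI e where
  homFinite : ∀ i j, IsFiniteLength K (corner (M := R) K (e j) (e i))
  primitive : ∀ i, IsPrimitive (e i)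
  noniso : ∀ i j, e i ≠ e j →
    ¬ ∃ φ : NUHom R (rightCorner R R (e i)) (rightCorner R R (e j)), Function.Bijective φ

/-- Support finiteness with respect to the family `e`: for every `i`, the sets
`Supp(R eᵢ) = {j | eⱼ R eᵢ ≠ 0}` and `Supp(eᵢ R) = {j | eᵢ R eⱼ ≠ 0}` are finite. -/
def SupportFinite {R I : Type*} [NonUnitalRing R] (e : I → R) : Prop :=
  ∀ i, {j | ∃ r : R, e j * r * e i ≠ 0}.Finite ∧ {j | ∃ r : R, e i * r * e j ≠ 0}.Finite

/-! ### The lower triangular matrix algebra -/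

/-- The matrices with diagonal entries `t ∈ T`, `u ∈ U`, lower left entry `m ∈ M` and upper right
entry `0`. -/
@[ext] structure Tri (T M U : Type*) where
  t : T
  m : M
  u : U

namespace Tri

variable {T M U : Type*} [NonUnitalRing U] [NonUnitalRing T] [AddCommGroup M]

instance : Zero (Tri T M U) := ⟨⟨0, 0, 0⟩⟩
instance : Add (Tri T M U) := ⟨fun a b => ⟨a.t + b.t, a.m + b.m, a.u + b.u⟩⟩
instance : Neg (Tri T M U) := ⟨fun a => ⟨-a.t, -a.m, -a.u⟩⟩

@[simp] theorem zero_t : (0 : Tri T M U).t = 0 := rfl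
@[simp] theorem zero_m : (0 : Tri T M U).m = 0 := rfl
@[simp] theorem zero_u : (0 : Tri T M U).u = 0 := rfl
@[simp] theorem add_t (a b : Tri T M U) : (a + b).t = a.t + b.t := rfl
@[simp] theorem add_m (a b : Tri T M U) : (a + b).m = a.m + b.m := rfl
@[simp] theorem add_u (a b : Tri T M U) : (a + b).u = a.u + b.u := rfl
@[simp] theorem neg_t (a : Tri T M U) : (-a).t = -a.t := rfl
@[simp] theorem neg_m (a : Tri T M U) : (-a).m = -a.m := rfl
@[simp] theorem neg_u (a : Tri T M U) : (-a).u = -a.u := rfl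

instance : AddCommGroup (Tri T M U) where
  add_assoc _ _ _ := by ext <;> simp [add_assoc]
  zero_add _ := by ext <;> simp
  add_zero _ := by ext <;> simp
  add_comm _ _ := by ext <;> simp [add_comm]
  neg_add_cancel _ := by ext <;> simp
  nsmul := nsmulRec
  zsmul := zsmulRec

variable [SMul U M] [SMul Tᵐᵒᵖ M]

instance : Mul (Tri T M U) :=
  ⟨fun a b => ⟨a.t * b.t, MulOpposite.op b.t • a.m + a.u • b.m, a.u * b.u⟩⟩

@[simp] theorem mul_t (a b : Tri T M U) : (a * b).t = a.t * b.t := rfl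
@[simp] theorem mul_m (a b : Tri T M U) :
    (a * b).m = MulOpposite.op b.t • a.m + a.u • b.m := rfl
@[simp] theorem mul_u (a b : Tri T M U) : (a * b).u = a.u * b.u := rfl

variable [IsNUModule U M] [IsNUModule Tᵐᵒᵖ M] [SMulCommClass U Tᵐᵒᵖ M]

instance : NonUnitalRing (Tri T M U) where
  left_distrib a b c := by
    ext
    · simp [mul_add]
    · simp only [mul_m, add_m, add_t, MulOpposite.op_add, IsNUModule.add_smul,
        IsNUModule.smul_add]
      abel
    · simp [mul_add]
  right_distrib a b c := by
    ext
    · simp [add_mul]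
    · simp only [mul_m, add_m, add_u, IsNUModule.add_smul, IsNUModule.smul_add]
      abel
    · simp [add_mul]
  zero_mul a := by ext <;> simp [nu_smul_zero, nu_zero_smul]
  mul_zero a := by ext <;> simp [nu_smul_zero, nu_zero_smul]
  mul_assoc a b c := by
    ext
    · simp [mul_assoc]
    · simp only [mul_m, mul_t, mul_u, MulOpposite.op_mul, IsNUModule.smul_add,
        IsNUModule.mul_smul, smul_comm a.u (MulOpposite.op c.t) b.m]
      abel
    · simp [mul_assoc]

/-- The idempotents of the triangular matrix algebra that come from those of `U` and `T`. -/
def idem {I J : Type*} (M : Type*) [AddCommGroup M] (e : I → U) (f : J → T) :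
    I ⊕ J → Tri T M U
  | Sum.inl i => ⟨0, 0, e i⟩
  | Sum.inr j => ⟨f j, 0, 0⟩

section algebra

variable {K : Type*} [CommRing K] [Module K T] [Module K M] [Module K U]

instance : SMul K (Tri T M U) := ⟨fun k a => ⟨k • a.t, k • a.m, k • a.u⟩⟩

@[simp] theorem smul_t (k : K) (a : Tri T M U) : (k • a).t = k • a.t := rfl
@[simp] theorem smul_m (k : K) (a : Tri T M U) : (k • a).m = k • a.m := rfl
@[simp] theorem smul_u (k : K) (a : Tri T M U) : (k • a).u = k • a.u := rfl

/-- The `K`-algebra structure of the triangular matrix algebra (with the next two instances). -/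
instance : Module K (Tri T M U) where
  one_smul _ := by ext <;> simp
  mul_smul _ _ _ := by ext <;> simp [mul_smul]
  smul_zero _ := by ext <;> simp
  zero_smul _ := by ext <;> simp
  smul_add _ _ _ := by ext <;> simp
  add_smul _ _ _ := by ext <;> simp [add_smul]

instance [IsScalarTower K T T] [IsScalarTower K U U] [IsScalarTower K U M]
    [SMulCommClass K Tᵐᵒᵖ M] : IsScalarTower K (Tri T M U) (Tri T M U) where
  smul_assoc k a b := by
    ext
    · simp [smul_mul_assoc]
    · change MulOpposite.op b.t • k • a.m + (k • a.u) • b.m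
        = k • (MulOpposite.op b.t • a.m + a.u • b.m)
      rw [smul_add, smul_comm k (MulOpposite.op b.t) a.m, smul_assoc]
    · simp [smul_mul_assoc]

instance [SMulCommClass K T T] [SMulCommClass K U U] [SMulCommClass K U M]
    [IsScalarTower K Tᵐᵒᵖ M] : SMulCommClass K (Tri T M U) (Tri T M U) where
  smul_comm k a b := by
    ext
    · simp [mul_smul_comm]
    · change k • (MulOpposite.op b.t • a.m + a.u • b.m)
        = MulOpposite.op (k • b.t) • a.m + a.u • k • b.m
      rw [smul_add, smul_comm k a.u b.m, MulOpposite.op_smul, smul_assoc]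
    · simp [mul_smul_comm]

end algebra

end Tri

/-! ### The tensor product over `T`, and triples -/

section tensor

variable (T M Y : Type*) [NonUnitalRing T] [AddCommGroup M] [SMul Tᵐᵒᵖ M]
  [AddCommGroup Y] [SMul T Y]

/-- The relations `m t ⊗ y = m ⊗ t y`. -/
def balRel : AddSubgroup (M ⊗[ℤ] Y) :=
  AddSubgroup.closure {z | ∃ (m : M) (t : T) (y : Y),
    z = (MulOpposite.op t • m) ⊗ₜ[ℤ] y - m ⊗ₜ[ℤ] (t • y)}

/-- The tensor product `M ⊗_T Y` of a right and a left `T`-module. -/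
def BalTensor : Type _ := (M ⊗[ℤ] Y) ⧸ balRel T M Y

instance : AddCommGroup (BalTensor T M Y) :=
  inferInstanceAs (AddCommGroup ((M ⊗[ℤ] Y) ⧸ balRel T M Y))

variable {M Y}

/-- The pure tensor `m ⊗ y` in `M ⊗_T Y`. -/
def BalTensor.tmul (m : M) (y : Y) : BalTensor T M Y :=
  QuotientAddGroup.mk' (balRel T M Y) (m ⊗ₜ[ℤ] y)

theorem BalTensor.add_tmul (m m' : M) (y : Y) :
    BalTensor.tmul T (m + m') y = BalTensor.tmul T m y + BalTensor.tmul T m' y := by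
  unfold BalTensor.tmul
  rw [TensorProduct.add_tmul]
  exact map_add _ _ _

theorem BalTensor.tmul_add (m : M) (y y' : Y) :
    BalTensor.tmul T m (y + y') = BalTensor.tmul T m y + BalTensor.tmul T m y' := by
  unfold BalTensor.tmul
  rw [TensorProduct.tmul_add]
  exact map_add _ _ _

theorem BalTensor.smul_tmul (m : M) (t : T) (y : Y) :
    BalTensor.tmul T (MulOpposite.op t • m) y = BalTensor.tmul T m (t • y) := by
  refine (QuotientAddGroup.eq_iff_sub_mem (N := balRel T M Y)).2 ?_
  exact AddSubgroup.subset_closure ⟨m, t, y, rfl⟩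

variable (M Y)
variable {U : Type*} [NonUnitalRing U] [SMul U M] [IsNUModule U M] [SMulCommClass U Tᵐᵒᵖ M]

/-- The action of `r ∈ U` on `M ⊗_T Y`, namely `m ⊗ y ↦ r m ⊗ y`. -/
def BalTensor.act (r : U) : BalTensor T M Y →+ BalTensor T M Y :=
  QuotientAddGroup.map (balRel T M Y) (balRel T M Y)
    ((actHom (N := M) r).toIntLinearMap.rTensor Y).toAddMonoidHom (by
      rw [balRel, AddSubgroup.closure_le]
      rintro _ ⟨m, t, y, rfl⟩
      refine AddSubgroup.subset_closure ⟨r • m, t, y, ?_⟩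
      rw [LinearMap.toAddMonoidHom_coe, map_sub, LinearMap.rTensor_tmul,
        LinearMap.rTensor_tmul]
      simp only [AddMonoidHom.coe_toIntLinearMap, actHom_apply]
      rw [smul_comm r (MulOpposite.op t) m])

instance : SMul U (BalTensor T M Y) := ⟨fun r z => BalTensor.act T M Y r z⟩

variable {M Y}

theorem BalTensor.smul_def (r : U) (m : M) (y : Y) :
    r • BalTensor.tmul T m y = BalTensor.tmul T (r • m) y := rfl

end tensor

section triples

variable (T M U : Type u) [NonUnitalRing U] [NonUnitalRing T] [AddCommGroup M]
  [SMul U M] [IsNUModule U M] [SMul Tᵐᵒᵖ M] [IsNUModule Tᵐᵒᵖ M] [SMulCommClass U Tᵐᵒᵖ M]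

/-- A triple `(Y, φ, X)` with `Y ∈ Mod(T)`, `X ∈ Mod(U)` and `φ : M ⊗_T Y → X` a homomorphism of
left `U`-modules. -/
structure Triple where
  Y : UMod T
  X : UMod U
  φ : NUHom U (BalTensor T M Y.carrier) X.carrier

namespace Triple

variable {T M U} (L : Triple T M U)

/-- The columns with entries `y ∈ Y` and `x ∈ X`, the underlying set of the module over the
triangular matrix algebra. -/
@[ext] structure Col where
  y : L.Y.carrier
  x : L.X.carrier

variable {L}

instance : Zero L.Col := ⟨⟨0, 0⟩⟩
instance : Add L.Col := ⟨fun p q => ⟨p.y + q.y, p.x + q.x⟩⟩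
instance : Neg L.Col := ⟨fun p => ⟨-p.y, -p.x⟩⟩

/-- `(t, m, u) • (y, x) = (t y, φ(m ⊗ y) + u x)`. -/
instance : SMul (Tri T M U) L.Col :=
  ⟨fun a p => ⟨a.t • p.y, L.φ (BalTensor.tmul T a.m p.y) + a.u • p.x⟩⟩

@[simp] theorem zero_y : (0 : L.Col).y = 0 := rfl
@[simp] theorem zero_x : (0 : L.Col).x = 0 := rfl
@[simp] theorem add_y (p q : L.Col) : (p + q).y = p.y + q.y := rfl
@[simp] theorem add_x (p q : L.Col) : (p + q).x = p.x + q.x := rfl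
@[simp] theorem neg_y (p : L.Col) : (-p).y = -p.y := rfl
@[simp] theorem neg_x (p : L.Col) : (-p).x = -p.x := rfl
@[simp] theorem smul_y (a : Tri T M U) (p : L.Col) : (a • p).y = a.t • p.y := rfl
@[simp] theorem smul_x (a : Tri T M U) (p : L.Col) :
    (a • p).x = L.φ (BalTensor.tmul T a.m p.y) + a.u • p.x := rfl

instance : AddCommGroup L.Col where
  add_assoc _ _ _ := by ext <;> simp [add_assoc]
  zero_add _ := by ext <;> simp
  add_zero _ := by ext <;> simp
  add_comm _ _ := by ext <;> simp [add_comm]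
  neg_add_cancel _ := by ext <;> simp
  nsmul := nsmulRec
  zsmul := zsmulRec

variable (L)

theorem φ_add (z z' : BalTensor T M L.Y.carrier) : L.φ (z + z') = L.φ z + L.φ z' :=
  L.φ.toAddMonoidHom.map_add z z'

theorem φ_smul (r : U) (z : BalTensor T M L.Y.carrier) : L.φ (r • z) = r • L.φ z :=
  L.φ.map_smul' r z

theorem φ_zero_tmul (y : L.Y.carrier) : L.φ (BalTensor.tmul T (0 : M) y) = 0 := by
  have h := L.φ_add (BalTensor.tmul T (0 : M) y) (BalTensor.tmul T (0 : M) y)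
  rw [← BalTensor.add_tmul, add_zero] at h
  exact left_eq_add.mp h

theorem φ_tmul_zero (m : M) : L.φ (BalTensor.tmul T m (0 : L.Y.carrier)) = 0 := by
  have h := L.φ_add (BalTensor.tmul T m 0) (BalTensor.tmul T m 0)
  rw [← BalTensor.tmul_add, add_zero] at h
  exact left_eq_add.mp h

instance : IsNUModule (Tri T M U) L.Col where
  smul_add a p q := by
    ext
    · simp [IsNUModule.smul_add]
    · simp only [smul_x, add_x, add_y, BalTensor.tmul_add, φ_add, IsNUModule.smul_add]
      abel
  add_smul a b p := by
    ext
    · simp [IsNUModule.add_smul]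
    · simp only [smul_x, add_x, Tri.add_m, Tri.add_u, BalTensor.add_tmul, φ_add,
        IsNUModule.add_smul]
      abel
  mul_smul a b p := by
    ext
    · simp [IsNUModule.mul_smul]
    · simp only [smul_x, smul_y, Tri.mul_m, Tri.mul_u, BalTensor.add_tmul, φ_add,
        IsNUModule.smul_add, BalTensor.smul_tmul, ← BalTensor.smul_def, φ_smul,
        IsNUModule.mul_smul]
      abel

theorem isUnitary_col : IsUnitary (Tri T M U) L.Col := by
  intro p
  let inY : L.Y.carrier →+ L.Col :=
    AddMonoidHom.mk' (fun y => ⟨y, 0⟩) fun y y' => by ext <;> simp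
  let inX : L.X.carrier →+ L.Col :=
    AddMonoidHom.mk' (fun x => ⟨0, x⟩) fun x x' => by ext <;> simp
  have hp : p = inY p.y + inX p.x := Col.ext (add_zero p.y).symm (zero_add p.x).symm
  have hY := AddSubgroup.mem_map_of_mem inY (L.Y.unitary p.y)
  have hX := AddSubgroup.mem_map_of_mem inX (L.X.unitary p.x)
  rw [AddMonoidHom.map_closure] at hY hX
  rw [hp]
  refine add_mem (AddSubgroup.closure_mono ?_ hY) (AddSubgroup.closure_mono ?_ hX)
  · rintro _ ⟨_, ⟨⟨r, y⟩, rfl⟩, rfl⟩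
    refine ⟨(⟨r, 0, 0⟩, inY y), Col.ext rfl ?_⟩
    change L.φ (BalTensor.tmul T (0 : M) y) + (0 : U) • (0 : L.X.carrier) = 0
    rw [φ_zero_tmul, nu_zero_smul, add_zero]
  · rintro _ ⟨_, ⟨⟨r, x⟩, rfl⟩, rfl⟩
    refine ⟨(⟨0, 0, r⟩, inX x), Col.ext (nu_smul_zero (0 : T)) ?_⟩
    change L.φ (BalTensor.tmul T (0 : M) (0 : L.Y.carrier)) + r • x = r • x
    rw [φ_zero_tmul, zero_add]

/-- The unitary module over the triangular matrix algebra given by the triple `(Y, φ, X)`. -/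
def toUMod : UMod (Tri T M U) where
  carrier := L.Col
  unitary := L.isUnitary_col

end Triple

end triples

/-- The unitary left `U`-module `M f`. -/
def colMod {U T M : Type u} [NonUnitalRing U] [NonUnitalRing T] [AddCommGroup M]
    [SMul U M] [IsNUModule U M] [SMul Tᵐᵒᵖ M] [IsNUModule Tᵐᵒᵖ M] [SMulCommClass U Tᵐᵒᵖ M]
    (h : IsUnitary U M) (f : T) : UMod U where
  carrier := rightCorner T M f
  unitary := isUnitary_rightCorner h f

end TriAlg

/-!
Write `Λ` for the triangular matrix algebra. Every unitary `Λ`-module `N` has a `U`-part `X = U N`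
and a `T`-part `Y = T N`, and `N` is an extension of `(Y, 0, 0)` by `(0, 0, X)` (`Tri.parts_ses`).
Everything follows from comparing the projective dimensions of these four modules.

* `X ↦ (0, 0, X)` is exact and preserves projective modules, so it preserves the projective
  dimension (`pd_inflU`); the `T`-part is exact and preserves projective modules, so it does not
  raise it (`Tri.pdle_partT`). The column of `Λ` at `fⱼ` is an extension of `(T fⱼ, 0, 0)` by
  `(0, 0, M fⱼ)`, hence `pd (T fⱼ, 0, 0) ≤ pd (M fⱼ) + 1` (`Tri.pdle_inflT_col`).
* Support finiteness and the length conditions make the columns `Λ εₐ` and `T fⱼ` Noetherian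
  (`UMod.isNoetherian_col`), so a finitely generated module has a resolution by finite sums of
  columns. Along such a resolution, an exact functor that sends columns to modules of finite
  projective dimension sends finitely generated modules of finite projective dimension to modules
  of finite projective dimension, and a bound `d` on the columns gives `n + d` on modules of
  projective dimension `n` (`UMod.ExactAssignment.exists_pdle`, `UMod.ExactAssignment.pdle`).
* Applied to the `U`-part, whose values on columns are `U eᵢ` and `M fⱼ`, and to `Y ↦ (Y, 0, 0)`,
  this gives the equivalence `finPD_iff_parts` and the bound
  `pd N ≤ max (pd X) (pd Y + 1 + m)` (`pd_le_max_parts`). The lower bounds hold even without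
  subtracting `m`.

The homological algebra is that of modules over the unital ring `ℤ ⊕ R`. Since the modules `R eᵢ`
are projective over `ℤ ⊕ R` and submodules of unitary modules are unitary, projective resolutions
in `Mod(R)` compute the projective dimension over `ℤ ⊕ R` (`UMod.hasProjRes_iff`), for which
Mathlib has the long exact sequence of `Ext`.
-/

namespace TriAlg

/-! ### Homomorphisms, short exact sequences and retracts -/

namespace NUHom

variable {R A B C : Type*} [AddCommGroup A] [SMul R A] [AddCommGroup B] [SMul R B]
  [AddCommGroup C] [SMul R C]

instance : AddMonoidHomClass (NUHom R A B) A B where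
  map_add f := f.toAddMonoidHom.map_add
  map_zero f := f.toAddMonoidHom.map_zero

theorem map_smul (f : NUHom R A B) (r : R) (x : A) : f (r • x) = r • f x := f.map_smul' r x

/-- The composite `g ∘ f`. -/
def comp (g : NUHom R B C) (f : NUHom R A B) : NUHom R A C where
  toAddMonoidHom := g.toAddMonoidHom.comp f.toAddMonoidHom
  map_smul' r x := by
    change g (f (r • x)) = r • g (f x)
    rw [map_smul, map_smul]

@[simp] theorem comp_apply (g : NUHom R B C) (f : NUHom R A B) (x : A) : g.comp f x = g (f x) :=
  rfl

/-- The inverse of a bijective homomorphism. -/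
noncomputable def inverse (f : NUHom R A B) (hf : Function.Bijective f) : NUHom R B A where
  toAddMonoidHom := (AddEquiv.ofBijective f hf).symm.toAddMonoidHom
  map_smul' r x := by
    obtain ⟨a, rfl⟩ := hf.2 x
    refine hf.1 ?_
    change AddEquiv.ofBijective f hf ((AddEquiv.ofBijective f hf).symm (r • f a))
      = f (r • (AddEquiv.ofBijective f hf).symm (AddEquiv.ofBijective f hf a))
    rw [AddEquiv.apply_symm_apply, AddEquiv.symm_apply_apply, map_smul]

theorem apply_inverse (f : NUHom R A B) (hf : Function.Bijective f) (x : B) :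
    f (f.inverse hf x) = x :=
  (AddEquiv.ofBijective f hf).apply_symm_apply x

theorem inverse_apply (f : NUHom R A B) (hf : Function.Bijective f) (x : A) :
    f.inverse hf (f x) = x :=
  (AddEquiv.ofBijective f hf).symm_apply_apply x

end NUHom

/-- The unitization `ℤ ⊕ R` of `R`, with its ring structure as the only instance. -/
def Unital (R : Type u) [NonUnitalRing R] : Type u := Unitization ℤ R

namespace Unital

variable {R : Type u} [NonUnitalRing R]

instance : Ring (Unital R) := inferInstanceAs (Ring (Unitization ℤ R))

/-- The component in `ℤ`. -/
def int (a : Unital R) : ℤ := (show Unitization ℤ R from a).toProd.1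

/-- The component in `R`. -/
def elt (a : Unital R) : R := (show Unitization ℤ R from a).toProd.2

/-- The inclusion of `R`. -/
def of (r : R) : Unital R := Unitization.inr r

theorem ext {a b : Unital R} (h1 : a.int = b.int) (h2 : a.elt = b.elt) : a = b :=
  Unitization.ext h1 h2

@[simp] theorem int_mul (a b : Unital R) : (a * b).int = a.int * b.int := rfl
@[simp] theorem elt_mul (a b : Unital R) :
    (a * b).elt = a.int • b.elt + b.int • a.elt + a.elt * b.elt := rfl
@[simp] theorem int_of (r : R) : (of r).int = 0 := rfl
@[simp] theorem elt_of (r : R) : (of r).elt = r := rfl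
@[simp] theorem of_zero : of (0 : R) = 0 := rfl

theorem of_add (r s : R) : of (r + s) = of r + of s := ext rfl rfl
theorem of_mul (r s : R) : of (r * s) = of r * of s := ext rfl (by simp)

end Unital

namespace UMod

variable {R : Type u} [NonUnitalRing R]

/-- There is a short exact sequence `0 → A → B → C → 0`. -/
def SES (A B C : UMod R) : Prop :=
  ∃ (i : NUHom R A.carrier B.carrier) (p : NUHom R B.carrier C.carrier),
    Function.Injective i ∧ Function.Surjective p ∧ ∀ x, p x = 0 ↔ ∃ y, i y = x

/-- `A` is a retract, i.e. isomorphic to a direct summand, of `B`. -/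
def Retract (A B : UMod R) : Prop :=
  ∃ (s : NUHom R A.carrier B.carrier) (p : NUHom R B.carrier A.carrier), ∀ x, p (s x) = x

theorem Retract.of_bijective {A B : UMod R} (f : NUHom R A.carrier B.carrier)
    (hf : Function.Bijective f) : Retract A B :=
  ⟨f, f.inverse hf, f.inverse_apply hf⟩

theorem Retract.of_bijective' {A B : UMod R} (f : NUHom R A.carrier B.carrier)
    (hf : Function.Bijective f) : Retract B A :=
  ⟨f.inverse hf, f, f.apply_inverse hf⟩

theorem IsProjective.retract {A B : UMod R} (hA : A.IsProjective)
    (p : NUHom R B.carrier A.carrier) (hp : Function.Surjective p) : Retract A B := by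
  obtain ⟨s, hs⟩ := hA B A p ⟨AddMonoidHom.id _, fun _ _ => rfl⟩ hp
  exact ⟨s, p, hs⟩

/-! ### Unitary modules as modules over the unitization -/

/-- A module over `R` is a module over the unital ring `ℤ ⊕ R`. -/
instance instModuleUnital (N : UMod R) : Module (Unital R) N.carrier where
  smul a x := a.int • x + a.elt • x
  one_smul x := by
    change (1 : ℤ) • x + (0 : R) • x = x
    rw [one_smul, nu_zero_smul, add_zero]
  mul_smul a b x := by
    change (a * b).int • x + (a * b).elt • x
      = a.int • (b.int • x + b.elt • x) + a.elt • (b.int • x + b.elt • x)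
    have h1 : a.elt • (b.int • x) = b.int • (a.elt • x) :=
      map_zsmul (actHom (N := N.carrier) a.elt) b.int x
    have h2 : ∀ (k : ℤ) (r : R), (k • r) • x = k • (r • x) := fun k r =>
      map_zsmul (AddMonoidHom.mk' (fun r : R => r • x) fun r s => IsNUModule.add_smul r s x) k r
    simp only [Unital.int_mul, Unital.elt_mul, IsNUModule.smul_add, IsNUModule.add_smul,
      IsNUModule.mul_smul, smul_add, mul_smul, h1, h2]
    abel
  smul_zero a := by
    change a.int • (0 : N.carrier) + a.elt • (0 : N.carrier) = 0
    rw [smul_zero, nu_smul_zero, add_zero]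
  smul_add a x y := by
    change a.int • (x + y) + a.elt • (x + y) = (a.int • x + a.elt • x) + (a.int • y + a.elt • y)
    rw [smul_add, IsNUModule.smul_add]
    abel
  add_smul a b x := by
    change (a.int + b.int) • x + (a.elt + b.elt) • x
      = (a.int • x + a.elt • x) + (b.int • x + b.elt • x)
    rw [add_smul, IsNUModule.add_smul]
    abel
  zero_smul x := by
    change (0 : ℤ) • x + (0 : R) • x = 0
    rw [zero_smul, nu_zero_smul, add_zero]

theorem unital_smul_def {N : UMod R} (a : Unital R) (x : N.carrier) :
    a • x = a.int • x + a.elt • x := rfl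

theorem of_smul {N : UMod R} (r : R) (x : N.carrier) : Unital.of r • x = r • x := by
  change (0 : ℤ) • x + r • x = r • x
  rw [zero_smul, zero_add]

/-- A homomorphism of `R`-modules as a linear map over the unitization. -/
def toLin {A B : UMod R} (f : NUHom R A.carrier B.carrier) :
    A.carrier →ₗ[Unital R] B.carrier where
  toFun := f
  map_add' := map_add f
  map_smul' a x := by
    rw [unital_smul_def, map_add, map_zsmul, NUHom.map_smul]
    rfl

/-- A linear map over the unitization as a homomorphism of `R`-modules. -/
def ofLin {A B : UMod R} (f : A.carrier →ₗ[Unital R] B.carrier) :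
    NUHom R A.carrier B.carrier where
  toAddMonoidHom := f.toAddMonoidHom
  map_smul' r x := by
    change f (r • x) = r • f x
    rw [← of_smul, map_smul, of_smul]

end UMod

/-! ### Local units -/

/-- The consequences of `IsWEI` that the arguments use: the `eᵢ` are orthogonal idempotents, and
each element of `R` is fixed from the left, and from the right, by a finite sum of `eᵢ`. -/
structure LocalUnits {R I : Type*} [NonUnitalRing R] (e : I → R) : Prop where
  idem : ∀ i, e i * e i = e i
  orth : ∀ i j, i ≠ j → e i * e j = 0
  left : ∀ r : R, ∃ s : Finset I, (∑ i ∈ s, e i) * r = r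
  right : ∀ r : R, ∃ s : Finset I, r * (∑ i ∈ s, e i) = r

namespace LocalUnits

section ring

variable {R I : Type*} [NonUnitalRing R] {e : I → R}

theorem sum_mul_sum (idem : ∀ i, e i * e i = e i) (orth : ∀ i j, i ≠ j → e i * e j = 0)
    {s t : Finset I} (h : s ⊆ t) :
    (∑ i ∈ t, e i) * (∑ i ∈ s, e i) = ∑ i ∈ s, e i ∧
      (∑ i ∈ s, e i) * (∑ i ∈ t, e i) = ∑ i ∈ s, e i := by
  classical
  constructor
  · rw [Finset.mul_sum]
    refine Finset.sum_congr rfl fun j hj => ?_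
    rw [Finset.sum_mul, Finset.sum_eq_single j (fun b _ hb => orth b j hb)
      fun hb => absurd (h hj) hb, idem]
  · rw [Finset.sum_mul]
    refine Finset.sum_congr rfl fun j hj => ?_
    rw [Finset.mul_sum, Finset.sum_eq_single j (fun b _ hb => orth j b hb.symm)
      fun hb => absurd (h hj) hb, idem]

/-- A finite sum of `eᵢ` that fixes `x` can be enlarged. -/
theorem fix_mono {N : Type*} [AddCommGroup N] [SMul R N] [IsNUModule R N]
    (idem : ∀ i, e i * e i = e i) (orth : ∀ i j, i ≠ j → e i * e j = 0)
    {s t : Finset I} (h : s ⊆ t) {x : N} (hx : (∑ i ∈ s, e i) • x = x) :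
    (∑ i ∈ t, e i) • x = x := by
  rw [← hx, ← IsNUModule.mul_smul, (sum_mul_sum idem orth h).1]

theorem ofIsWEI (h : IsWEI e) : LocalUnits e := by
  classical
  refine ⟨h.idem, h.orth, fun r => ?_, fun r => ?_⟩
  · have hr : r ∈ ⨆ i, (AddMonoidHom.mulLeft (e i)).range := h.left_span ▸ AddSubgroup.mem_top r
    induction hr using AddSubgroup.iSup_induction' with
    | hp i x hx =>
      obtain ⟨y, rfl⟩ := hx
      exact ⟨{i}, by simp [← mul_assoc, h.idem]⟩
    | h1 => exact ⟨∅, by simp⟩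
    | hadd x y _ _ hx hy =>
      obtain ⟨s, hs⟩ := hx
      obtain ⟨t, ht⟩ := hy
      refine ⟨s ∪ t, ?_⟩
      have h1 := fix_mono (N := R) h.idem h.orth Finset.subset_union_left (t := s ∪ t) hs
      have h2 := fix_mono (N := R) h.idem h.orth Finset.subset_union_right (t := s ∪ t) ht
      rw [smul_eq_mul] at h1 h2
      rw [mul_add, h1, h2]
  · have hr : r ∈ ⨆ i, (AddMonoidHom.mulRight (e i)).range := h.right_span ▸ AddSubgroup.mem_top r
    induction hr using AddSubgroup.iSup_induction' with
    | hp i x hx =>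
      obtain ⟨y, rfl⟩ := hx
      exact ⟨{i}, by simp [mul_assoc, h.idem]⟩
    | h1 => exact ⟨∅, by simp⟩
    | hadd x y _ _ hx hy =>
      obtain ⟨s, hs⟩ := hx
      obtain ⟨t, ht⟩ := hy
      refine ⟨s ∪ t, ?_⟩
      have h1 : x * ∑ i ∈ s ∪ t, e i = x := by
        rw [← hs, mul_assoc, (sum_mul_sum h.idem h.orth Finset.subset_union_left).2]
      have h2 : y * ∑ i ∈ s ∪ t, e i = y := by
        rw [← ht, mul_assoc, (sum_mul_sum h.idem h.orth Finset.subset_union_right).2]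
      rw [add_mul, h1, h2]

/-- Local units of the ring fix the elements of unitary modules. -/
theorem exists_fix {N : Type*} [AddCommGroup N] [SMul R N] [IsNUModule R N]
    (h : LocalUnits e) (hN : IsUnitary R N) (x : N) : ∃ s : Finset I, (∑ i ∈ s, e i) • x = x := by
  classical
  induction hN x using AddSubgroup.closure_induction with
  | mem x hx =>
    obtain ⟨⟨r, y⟩, rfl⟩ := hx
    obtain ⟨s, hs⟩ := h.left r
    exact ⟨s, by rw [← IsNUModule.mul_smul, hs]⟩
  | zero => exact ⟨∅, nu_smul_zero _⟩
  | add x y _ _ hx hy =>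
    obtain ⟨s, hs⟩ := hx
    obtain ⟨t, ht⟩ := hy
    refine ⟨s ∪ t, ?_⟩
    rw [IsNUModule.smul_add, fix_mono h.idem h.orth Finset.subset_union_left hs,
      fix_mono h.idem h.orth Finset.subset_union_right ht]
  | neg x _ hx =>
    obtain ⟨s, hs⟩ := hx
    exact ⟨s, by rw [nu_smul_neg, hs]⟩

theorem exists_smul_eq {N : Type*} [AddCommGroup N] [SMul R N] [IsNUModule R N]
    (h : LocalUnits e) (hN : IsUnitary R N) (x : N) : ∃ r : R, r • x = x :=
  (h.exists_fix hN x).imp' _ fun _ hs => hs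

end ring

theorem isUnitary_of_fix {R N : Type*} [AddCommGroup N] [SMul R N]
    (h : ∀ x : N, ∃ r : R, r • x = x) : IsUnitary R N := fun x => by
  obtain ⟨r, hr⟩ := h x
  exact AddSubgroup.subset_closure ⟨(r, x), hr⟩

theorem isUnitary {R I : Type*} [NonUnitalRing R] {e : I → R} (h : LocalUnits e) :
    IsUnitary R R :=
  isUnitary_of_fix fun r => (h.left r).imp' _ fun _ hs => hs

end LocalUnits

namespace UMod

variable {R : Type u} [NonUnitalRing R] {I : Type*} {e : I → R}

/-! ### Submodules and kernels -/

instance {N : UMod R} (S : Submodule (Unital R) N.carrier) : SMul R S :=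
  ⟨fun r x => ⟨r • x.1, by rw [← of_smul]; exact S.smul_mem _ x.2⟩⟩

instance {N : UMod R} (S : Submodule (Unital R) N.carrier) : IsNUModule R S where
  smul_add r x y := Subtype.ext (IsNUModule.smul_add r x.1 y.1)
  add_smul r s x := Subtype.ext (IsNUModule.add_smul r s x.1)
  mul_smul r s x := Subtype.ext (IsNUModule.mul_smul r s x.1)

/-- A submodule of a unitary module, as a unitary module. -/
def ofSub (h : LocalUnits e) (N : UMod R) (S : Submodule (Unital R) N.carrier) :
    UMod R where
  carrier := S
  unitary := LocalUnits.isUnitary_of_fix fun x =>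
    (h.exists_smul_eq N.unitary x.1).imp fun _ hr => Subtype.ext hr

/-- The inclusion of a submodule. -/
def subIncl (h : LocalUnits e) (N : UMod R) (S : Submodule (Unital R) N.carrier) :
    NUHom R (ofSub h N S).carrier N.carrier where
  toAddMonoidHom := S.subtype.toAddMonoidHom
  map_smul' _ _ := rfl

theorem ker_ses (h : LocalUnits e) {N P : UMod R} (p : NUHom R P.carrier N.carrier)
    (hp : Function.Surjective p) : SES (ofSub h P (LinearMap.ker (toLin p))) P N :=
  ⟨subIncl h P _, p, Subtype.val_injective, hp, fun x =>
    ⟨fun hx => ⟨⟨x, hx⟩, rfl⟩, by rintro ⟨y, rfl⟩; exact y.2⟩⟩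

/-! ### Projective modules -/

theorem isProjective_of_module_projective (P : UMod R)
    [hP : Module.Projective (Unital R) P.carrier] : P.IsProjective := by
  intro A B g k hg
  obtain ⟨l, hl⟩ := Module.projective_lifting_property (toLin g) (toLin k) hg
  exact ⟨ofLin l, fun x => LinearMap.congr_fun hl x⟩

/-- The regular module. -/
def regular (h : LocalUnits e) : UMod R where
  carrier := R
  unitary := h.isUnitary

theorem mul_eq_zero_of_notMem (h : LocalUnits e) {r : R} {t : Finset I}
    (ht : r * (∑ i ∈ t, e i) = r) {i : I} (hi : i ∉ t) : r * e i = 0 := by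
  rw [← ht, mul_assoc, Finset.sum_mul, Finset.sum_eq_zero, mul_zero]
  exact fun j hj => h.orth j i fun hji => hi (hji ▸ hj)

theorem finite_support_mul (h : LocalUnits e) (r : R) :
    (Function.support fun i => Unital.of (r * e i)).Finite := by
  obtain ⟨s, hs⟩ := h.right r
  refine s.finite_toSet.subset fun i hi => ?_
  by_contra his
  exact hi (by simp only [mul_eq_zero_of_notMem h hs his, Unital.of_zero])

/-- The regular module `R = ⨁ R eᵢ` is projective over the unitization: it is a retract of the
free module with basis indexed by `I`, through `r ↦ (r eᵢ)ᵢ`. -/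
theorem module_projective_regular (h : LocalUnits e) :
    Module.Projective (Unital R) (regular h).carrier := by
  let s : (regular h).carrier →ₗ[Unital R] (I →₀ Unital R) :=
    { toFun := fun r : R => Finsupp.ofSupportFinite (fun i => Unital.of (r * e i))
        (finite_support_mul h r)
      map_add' := fun r r' : R => Finsupp.ext fun i =>
        (congrArg Unital.of (add_mul r r' (e i))).trans (Unital.of_add _ _)
      map_smul' := fun (a : Unital R) (r : R) => Finsupp.ext fun i => by
        change Unital.of ((a.int • r + a.elt * r) * e i) = a * Unital.of (r * e i)
        refine Unital.ext ?_ ?_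
        · simp
        · simp [add_mul, mul_assoc, smul_mul_assoc] }
  let p : (I →₀ Unital R) →ₗ[Unital R] (regular h).carrier :=
    Finsupp.linearCombination (Unital R) (M := (regular h).carrier) e
  refine Module.Projective.of_split s p (LinearMap.ext fun r : R => ?_)
  obtain ⟨t, ht⟩ := h.right r
  have hsub : (s r).support ⊆ t := fun i hi => by
    by_contra hit
    refine Finsupp.mem_support_iff.1 hi ?_
    change Unital.of (r * e i) = 0
    rw [mul_eq_zero_of_notMem h ht hit, Unital.of_zero]
  let g (i : I) : (regular h).carrier := e i
  have hterm : ∀ i ∈ t, (s r) i • g i = r * e i := fun i _ => by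
    change Unital.of (r * e i) • g i = _
    rw [of_smul]
    change r * e i * e i = _
    rw [mul_assoc, h.idem]
  have hsum : ∑ i ∈ t, r * e i = r := by rw [← Finset.mul_sum, ht]
  have h1 : p (s r) = (s r).sum fun i a => a • g i := Finsupp.linearCombination_apply _ _
  rw [Finsupp.sum_of_support_subset (s r) hsub (fun i a => a • g i) fun i _ => zero_smul _ _] at h1
  exact h1.trans ((Finset.sum_congr rfl hterm).trans hsum)

/-- The module `R eᵢ`. -/
def col (h : LocalUnits e) (i : I) : UMod R := colMod h.isUnitary (e i)

theorem col_mul (h : LocalUnits e) (i : I) (x : (col h i).carrier) : x.1 * e i = x.1 := by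
  obtain ⟨_, m, rfl⟩ := x
  change m * e i * e i = m * e i
  rw [mul_assoc, h.idem]

/-- The generator `eᵢ` of `R eᵢ`. -/
def colGen (h : LocalUnits e) (i : I) : (col h i).carrier := ⟨e i, e i, h.idem i⟩

theorem module_projective_col (h : LocalUnits e) (i : I) :
    Module.Projective (Unital R) (col h i).carrier := by
  let s : (col h i).carrier →ₗ[Unital R] Unital R :=
    { toFun := fun x => Unital.of x.1
      map_add' := fun x y => Unital.of_add _ _
      map_smul' := fun a x => by
        change Unital.of (a.int • x.1 + a.elt * x.1)
          = a * Unital.of x.1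
        refine Unital.ext ?_ ?_ <;> simp }
  refine Module.Projective.of_split s (LinearMap.toSpanSingleton _ _ (colGen h i))
    (LinearMap.ext fun x => ?_)
  change Unital.of x.1 • colGen h i = x
  rw [of_smul]
  exact Subtype.ext (col_mul h i x)

theorem isProjective_col (h : LocalUnits e) (i : I) : (col h i).IsProjective :=
  have := module_projective_col h i
  isProjective_of_module_projective _

noncomputable instance {N : UMod R} (X : Type*) : SMul R (X →₀ N.carrier) :=
  ⟨fun r g => Unital.of r • g⟩

instance {N : UMod R} (X : Type*) : IsNUModule R (X →₀ N.carrier) where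
  smul_add r x y := smul_add (Unital.of r) x y
  add_smul r s x := by
    change Unital.of (r + s) • x = _
    rw [Unital.of_add, add_smul]
    rfl
  mul_smul r s x := by
    change Unital.of (r * s) • x = _
    rw [Unital.of_mul, mul_smul]
    rfl

/-- The direct sum of copies of the regular module indexed by the elements of `N`. -/
noncomputable def cover (h : LocalUnits e) (N : UMod R) : UMod R where
  carrier := N.carrier →₀ (regular h).carrier
  unitary := by
    intro g
    induction g using Finsupp.induction_linear with
    | zero => exact zero_mem _
    | add f g hf hg => exact add_mem hf hg
    | single a r =>
      obtain ⟨c, hc⟩ := h.exists_smul_eq (regular h).unitary r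
      refine AddSubgroup.subset_closure ⟨(c, Finsupp.single a r), ?_⟩
      change Unital.of c • Finsupp.single a r = _
      rw [Finsupp.smul_single, of_smul, hc]

/-- The two module structures over the unitization on `cover h N` agree. -/
noncomputable def coverEquiv (h : LocalUnits e) (N : UMod R) :
    (N.carrier →₀ (regular h).carrier) ≃ₗ[Unital R] (cover h N).carrier where
  toFun := id
  invFun := id
  left_inv _ := rfl
  right_inv _ := rfl
  map_add' _ _ := rfl
  map_smul' a x := by
    change a • x = (a.int • x + Unital.of a.elt • x :
      N.carrier →₀ (regular h).carrier)
    ext n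
    change a • x n = a.int • x n + Unital.of a.elt • x n
    rw [of_smul]
    rfl

theorem module_projective_cover (h : LocalUnits e) (N : UMod R) :
    Module.Projective (Unital R) (cover h N).carrier := by
  have := module_projective_regular h
  have : Module.Projective (Unital R) (N.carrier →₀ (regular h).carrier) := by
    classical
    exact Module.Projective.of_equiv (finsuppLequivDFinsupp (Unital R)).symm
  exact Module.Projective.of_equiv (coverEquiv h N)

/-- The homomorphism `r ↦ r n` from the regular module. -/
def smulHom {N : UMod R} (n : N.carrier) : NUHom R R N.carrier where
  toAddMonoidHom := AddMonoidHom.mk' (fun r : R => r • n) fun r s => IsNUModule.add_smul r s n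
  map_smul' r s := IsNUModule.mul_smul r s n

/-- Every unitary module is an image of a module in `Mod(R)` that is projective over the
unitization. -/
theorem exists_cover (h : LocalUnits e) (N : UMod R) :
    ∃ p : NUHom R (cover h N).carrier N.carrier, Function.Surjective p := by
  let act (n : N.carrier) : (regular h).carrier →ₗ[Unital R] N.carrier :=
    toLin (A := regular h) (B := N) (smulHom n)
  let p := Finsupp.lsum ℕ act
  refine ⟨ofLin (p.comp (coverEquiv h N).symm.toLinearMap), fun n => ?_⟩
  obtain ⟨r, hr⟩ := h.exists_smul_eq N.unitary n
  have h1 : p (Finsupp.single n (show (regular h).carrier from r)) = r • n :=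
    Finsupp.lsum_single ℕ act n _
  exact ⟨_, h1.trans hr⟩

/-- Projective objects of `Mod(R)` are retracts of direct sums of copies of `R`, so they remain
projective among all modules over the unitization. -/
theorem module_projective_of_isProjective (h : LocalUnits e) {P : UMod R} (hP : P.IsProjective) :
    Module.Projective (Unital R) P.carrier := by
  obtain ⟨p, hp⟩ := exists_cover h P
  obtain ⟨s, p, hs⟩ := hP.retract p hp
  have := module_projective_cover h P
  exact Module.Projective.of_split (toLin s) (toLin p) (LinearMap.ext hs)

/-! ### Projective dimension over the ring and over its unitization -/

open CategoryTheory in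
/-- `N` has projective dimension at most `n` as a module over the unitization. -/
def PDLE (n : ℕ) (N : UMod R) : Prop :=
  HasProjectiveDimensionLE (ModuleCat.of (Unital R) N.carrier) n

section

open CategoryTheory

/-- The short complex of modules over the unitization given by two composable homomorphisms. -/
def shortComplex {A B C : UMod R} (i : NUHom R A.carrier B.carrier)
    (p : NUHom R B.carrier C.carrier) (h : ∀ x, p (i x) = 0) :
    ShortComplex (ModuleCat.{u} (Unital R)) :=
  ShortComplex.moduleCatMk (toLin i) (toLin p) (LinearMap.ext h)

theorem SES.exists_shortExact {A B C : UMod R} (h : SES A B C) :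
    ∃ S : ShortComplex (ModuleCat.{u} (Unital R)), S.ShortExact ∧
      S.X₁ = ModuleCat.of _ A.carrier ∧ S.X₂ = ModuleCat.of _ B.carrier ∧
      S.X₃ = ModuleCat.of _ C.carrier := by
  obtain ⟨i, p, hi, hp, hx⟩ := h
  refine ⟨shortComplex i p fun x => (hx _).2 ⟨x, rfl⟩, ?_, rfl, rfl, rfl⟩
  exact ModuleCat.shortComplex_shortExact _ (fun x => hx x) hi hp

theorem PDLE.mid {A B C : UMod R} (h : SES A B C) {n : ℕ} (hA : PDLE n A) (hC : PDLE n C) :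
    PDLE n B := by
  obtain ⟨S, hS, h1, h2, h3⟩ := h.exists_shortExact
  unfold PDLE at *
  rw [← h1] at hA
  rw [← h3] at hC
  rw [← h2]
  exact hS.hasProjectiveDimensionLT_X₂ _ hA hC

theorem PDLE.right {A B C : UMod R} (h : SES A B C) {n : ℕ} (hA : PDLE n A)
    (hB : PDLE (n + 1) B) : PDLE (n + 1) C := by
  obtain ⟨S, hS, h1, h2, h3⟩ := h.exists_shortExact
  unfold PDLE at *
  rw [← h1] at hA
  rw [← h2] at hB
  rw [← h3]
  exact hS.hasProjectiveDimensionLT_X₃ _ hA hB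

theorem PDLE.left {A B C : UMod R} (h : SES A B C) {n : ℕ} (hB : PDLE n B)
    (hC : PDLE (n + 1) C) : PDLE n A := by
  obtain ⟨S, hS, h1, h2, h3⟩ := h.exists_shortExact
  unfold PDLE at *
  rw [← h3] at hC
  rw [← h2] at hB
  rw [← h1]
  exact hS.hasProjectiveDimensionLT_X₁ _ hB hC

theorem PDLE.mono {N : UMod R} {m n : ℕ} (h : PDLE m N) (hmn : m ≤ n) : PDLE n N :=
  have : HasProjectiveDimensionLT _ (m + 1) := h
  hasProjectiveDimensionLT_of_ge (ModuleCat.of (Unital R) N.carrier) (m + 1) (n + 1)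
    (by omega)

theorem PDLE.retract {A B : UMod R} (h : Retract A B) {n : ℕ} (hB : PDLE n B) : PDLE n A := by
  obtain ⟨s, p, hsp⟩ := h
  have : HasProjectiveDimensionLT _ (n + 1) := hB
  let r : CategoryTheory.Retract (ModuleCat.of (Unital R) A.carrier)
      (ModuleCat.of (Unital R) B.carrier) :=
    { i := ModuleCat.ofHom (toLin s)
      r := ModuleCat.ofHom (toLin p)
      retract := by
        ext x
        exact hsp x }
  exact r.hasProjectiveDimensionLT (n + 1)

theorem pdle_zero_iff (h : LocalUnits e) (N : UMod R) : PDLE 0 N ↔ N.IsProjective := by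
  unfold PDLE
  rw [← projective_iff_hasProjectiveDimensionLE_zero, ← IsProjective.iff_projective]
  exact ⟨fun _ => isProjective_of_module_projective N, module_projective_of_isProjective h⟩

end

/-- Projective resolutions in `Mod(R)` compute the projective dimension over the unitization. -/
theorem hasProjRes_iff (h : LocalUnits e) (n : ℕ) (N : UMod R) : HasProjRes n N ↔ PDLE n N := by
  induction n generalizing N with
  | zero => exact (pdle_zero_iff h N).symm
  | succ n ih =>
    constructor
    · rintro ⟨Q, P, i, p, hi, hp, hx, hP, hQ⟩
      exact PDLE.right ⟨i, p, hi, hp, hx⟩ ((ih Q).1 hQ)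
        (((pdle_zero_iff h P).2 hP).mono (Nat.zero_le _))
    · intro hN
      obtain ⟨p, hp⟩ := exists_cover h N
      have := module_projective_cover h N
      have hP := isProjective_of_module_projective (cover h N)
      have hs := ker_ses h p hp
      have hQ := PDLE.left hs (((pdle_zero_iff h _).2 hP).mono (Nat.zero_le n)) hN
      obtain ⟨i, p, hi, hp, hx⟩ := hs
      exact ⟨_, _, i, p, hi, hp, hx, hP, (ih _).2 hQ⟩

theorem pd_le_iff (h : LocalUnits e) (N : UMod R) (n : ℕ) : N.pd ≤ n ↔ PDLE n N := by
  constructor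
  · intro hN
    have hne : {d : ℕ∞ | ∃ n : ℕ, d = n ∧ HasProjRes n N}.Nonempty := by
      by_contra hemp
      rw [pd, Set.not_nonempty_iff_eq_empty.1 hemp, sInf_empty] at hN
      exact absurd hN (by simp)
    obtain ⟨k, hk, hres⟩ := csInf_mem hne
    refine ((hasProjRes_iff h k N).1 hres).mono ?_
    change N.pd = k at hk
    rw [hk] at hN
    exact_mod_cast hN
  · intro hN
    exact sInf_le ⟨n, rfl, (hasProjRes_iff h n N).2 hN⟩

theorem pd_lt_top_iff (h : LocalUnits e) (N : UMod R) : N.pd < ⊤ ↔ ∃ n, PDLE n N := by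
  constructor
  · intro hN
    obtain ⟨n, hn⟩ := ENat.ne_top_iff_exists.1 hN.ne
    exact ⟨n, (pd_le_iff h N n).1 hn.symm.le⟩
  · rintro ⟨n, hn⟩
    exact ((pd_le_iff h N n).2 hn).trans_lt (ENat.natCast_lt_top n)

/-! ### Finitely generated modules -/

theorem fg_iff (h : LocalUnits e) (N : UMod R) :
    N.FG ↔ (⊤ : Submodule (Unital R) N.carrier).FG := by
  constructor
  · rintro ⟨s, hs⟩
    refine ⟨s, top_unique fun x _ => ?_⟩
    refine (AddSubgroup.closure_le
      (Submodule.span (Unital R) (s : Set N.carrier)).toAddSubgroup).2 ?_ (hs x)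
    rintro _ ⟨r, a, ha, rfl⟩
    rw [← of_smul]
    exact Submodule.smul_mem _ _ (Submodule.subset_span ha)
  · rintro ⟨s, hs⟩
    refine ⟨s, fun x => ?_⟩
    have hx : x ∈ Submodule.span (Unital R) (s : Set N.carrier) := hs ▸ trivial
    induction hx using Submodule.span_induction with
    | mem x hx =>
      obtain ⟨r, hr⟩ := h.exists_smul_eq N.unitary x
      exact AddSubgroup.subset_closure ⟨r, x, hx, hr.symm⟩
    | zero => exact zero_mem _
    | add x y _ _ hx hy => exact add_mem hx hy
    | smul a x _ hx =>
      rw [unital_smul_def]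
      refine add_mem (zsmul_mem hx _) ?_
      have := AddSubgroup.mem_map_of_mem (actHom (N := N.carrier) a.elt) hx
      rw [AddMonoidHom.map_closure] at this
      refine AddSubgroup.closure_mono ?_ this
      rintro _ ⟨_, ⟨r, b, hb, rfl⟩, rfl⟩
      exact ⟨a.elt * r, b, hb, (IsNUModule.mul_smul _ _ _).symm⟩

theorem FG.of_surjective (h : LocalUnits e) {A B : UMod R} (hA : A.FG)
    (p : NUHom R A.carrier B.carrier) (hp : Function.Surjective p) : B.FG := by
  rw [fg_iff h] at hA ⊢
  have := hA.map (toLin p)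
  rwa [Submodule.map_top, LinearMap.range_eq_top.2 hp] at this

end UMod

namespace UMod

variable {R : Type u} [NonUnitalRing R] {I : Type*} {e : I → R}

/-! ### Finite direct sums of the modules `R eᵢ` -/

instance {A B : Type*} [AddCommGroup A] [SMul R A] [IsNUModule R A] [AddCommGroup B] [SMul R B]
    [IsNUModule R B] : IsNUModule R (A × B) where
  smul_add r x y := Prod.ext (IsNUModule.smul_add r x.1 y.1) (IsNUModule.smul_add r x.2 y.2)
  add_smul r s x := Prod.ext (IsNUModule.add_smul r s x.1) (IsNUModule.add_smul r s x.2)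
  mul_smul r s x := Prod.ext (IsNUModule.mul_smul r s x.1) (IsNUModule.mul_smul r s x.2)

/-- The zero module. -/
def zeroMod (R : Type u) [NonUnitalRing R] : UMod R where
  carrier := PUnit
  act := ⟨fun _ x => x⟩
  isMod :=
    { smul_add := fun _ _ _ => rfl
      add_smul := fun _ _ _ => rfl
      mul_smul := fun _ _ _ => rfl }
  unitary _ := zero_mem _

instance : Subsingleton (zeroMod R).carrier := inferInstanceAs (Subsingleton PUnit)

/-- The direct sum of two modules. -/
def prod (A B : UMod R) : UMod R where
  carrier := A.carrier × B.carrier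
  unitary := by
    rintro ⟨a, b⟩
    have ha := AddSubgroup.mem_map_of_mem (AddMonoidHom.inl A.carrier B.carrier) (A.unitary a)
    have hb := AddSubgroup.mem_map_of_mem (AddMonoidHom.inr A.carrier B.carrier) (B.unitary b)
    rw [AddMonoidHom.map_closure] at ha hb
    have hab : (a, b) = AddMonoidHom.inl A.carrier B.carrier a
        + AddMonoidHom.inr A.carrier B.carrier b := by simp
    rw [hab]
    refine add_mem (AddSubgroup.closure_mono ?_ ha) (AddSubgroup.closure_mono ?_ hb)
    · rintro _ ⟨_, ⟨⟨r, x⟩, rfl⟩, rfl⟩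
      exact ⟨(r, (x, 0)), Prod.ext rfl (nu_smul_zero r)⟩
    · rintro _ ⟨_, ⟨⟨r, x⟩, rfl⟩, rfl⟩
      exact ⟨(r, (0, x)), Prod.ext (nu_smul_zero r) rfl⟩

theorem prod_ses (A B : UMod R) : SES A (prod A B) B :=
  ⟨⟨AddMonoidHom.inl A.carrier B.carrier, fun r _ => Prod.ext rfl (nu_smul_zero r).symm⟩,
    ⟨AddMonoidHom.snd A.carrier B.carrier, fun _ _ => rfl⟩,
    fun _ _ hxy => congrArg Prod.fst hxy, fun b => ⟨(0, b), rfl⟩,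
    fun x => ⟨fun hx => ⟨x.1, Prod.ext rfl hx.symm⟩, by rintro ⟨y, rfl⟩; rfl⟩⟩

/-- The finite direct sums of modules `R eᵢ`. -/
inductive FinFree (h : LocalUnits e) : UMod R → Prop
  | zero : FinFree h (zeroMod R)
  | col (i : I) : FinFree h (col h i)
  | prod (A B : UMod R) : FinFree h A → FinFree h B → FinFree h (prod A B)

theorem pdle_of_subsingleton (h : LocalUnits e) (N : UMod R) [Subsingleton N.carrier] (n : ℕ) :
    PDLE n N := by
  refine ((pdle_zero_iff h N).2 fun A B g k _ => ⟨⟨0, fun r _ => (nu_smul_zero r).symm⟩, ?_⟩).mono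
    (Nat.zero_le n)
  intro x
  rw [Subsingleton.elim x 0, map_zero k]
  exact map_zero g

theorem FinFree.pdle {h : LocalUnits e} {F : UMod R} (hF : FinFree h F) : PDLE 0 F := by
  induction hF with
  | zero => exact pdle_of_subsingleton h _ _
  | col i => exact (pdle_zero_iff h _).2 (isProjective_col h i)
  | prod A B _ _ hA hB => exact PDLE.mid (prod_ses A B) hA hB

theorem isNoetherian_of_ses {A B C : UMod R} (hs : SES A B C)
    (hA : IsNoetherian (Unital R) A.carrier) (hC : IsNoetherian (Unital R) C.carrier) :
    IsNoetherian (Unital R) B.carrier := by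
  obtain ⟨i, p, -, -, hx⟩ := hs
  exact isNoetherian_of_range_eq_ker (toLin i) (toLin p)
    (Submodule.ext fun x => (hx x).symm)

theorem FinFree.isNoetherian {h : LocalUnits e}
    (hnoeth : ∀ i, IsNoetherian (Unital R) (UMod.col h i).carrier) {F : UMod R}
    (hF : FinFree h F) : IsNoetherian (Unital R) F.carrier := by
  induction hF with
  | zero => infer_instance
  | col i => exact hnoeth i
  | prod A B _ _ hA hB => exact isNoetherian_of_ses (prod_ses A B) hA hB

/-- The homomorphism `R eᵢ → N` that sends `eᵢ` to `eᵢ n`. -/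
def colHom (h : LocalUnits e) (i : I) {N : UMod R} (n : N.carrier) :
    NUHom R (col h i).carrier N.carrier where
  toAddMonoidHom := (smulHom n).toAddMonoidHom.comp (rightCorner R R (e i)).subtype
  map_smul' r x := IsNUModule.mul_smul r x.1 n

/-- The homomorphism on a direct sum with given components. -/
def coprod {A B N : UMod R} (p : NUHom R A.carrier N.carrier) (q : NUHom R B.carrier N.carrier) :
    NUHom R (prod A B).carrier N.carrier where
  toAddMonoidHom := p.toAddMonoidHom.coprod q.toAddMonoidHom
  map_smul' r x := by
    change p (r • x.1) + q (r • x.2) = r • (p x.1 + q x.2)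
    rw [NUHom.map_smul, NUHom.map_smul, IsNUModule.smul_add]

/-- A finitely generated submodule is covered by a finite sum of modules `R eᵢ`: a generator `x` is
a finite sum of elements `eᵢ x`, and `eᵢ x` is the image of `eᵢ` under `R eᵢ → N`, `r ↦ r x`. -/
theorem exists_finFree_range (h : LocalUnits e) {N : UMod R}
    {S : Submodule (Unital R) N.carrier} (hS : S.FG) :
    ∃ F, FinFree h F ∧ ∃ p : NUHom R F.carrier N.carrier, S ≤ LinearMap.range (toLin p) := by
  classical
  have sup : ∀ S S' T : Submodule (Unital R) N.carrier,
      (∃ F, FinFree h F ∧ ∃ p : NUHom R F.carrier N.carrier, S ≤ LinearMap.range (toLin p)) →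
      (∃ F, FinFree h F ∧ ∃ p : NUHom R F.carrier N.carrier, S' ≤ LinearMap.range (toLin p)) →
      T ≤ S ⊔ S' →
      ∃ F, FinFree h F ∧ ∃ p : NUHom R F.carrier N.carrier, T ≤ LinearMap.range (toLin p) := by
    rintro S S' T ⟨F, hF, p, hp⟩ ⟨F', hF', p', hp'⟩ hT
    refine ⟨prod F F', .prod F F' hF hF', coprod p p', hT.trans (sup_le ?_ ?_)⟩
    · refine hp.trans ?_
      rintro _ ⟨x, rfl⟩
      refine ⟨(x, 0), ?_⟩
      change p x + p' 0 = p x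
      rw [map_zero, add_zero]
    · refine hp'.trans ?_
      rintro _ ⟨x, rfl⟩
      refine ⟨(0, x), ?_⟩
      change p 0 + p' x = p' x
      rw [map_zero, zero_add]
  refine Submodule.fg_induction (motive := fun S _ => ∃ F, FinFree h F ∧
    ∃ p : NUHom R F.carrier N.carrier, S ≤ LinearMap.range (toLin p)) (fun x => ?_)
    (fun S S' _ _ h1 h2 => sup S S' _ h1 h2 le_rfl) S hS
  obtain ⟨s, hs⟩ := h.exists_fix N.unitary x
  rw [← hs]
  clear hs
  induction s using Finset.induction_on with
  | empty =>
    refine ⟨zeroMod R, .zero, ⟨0, fun r _ => (nu_smul_zero r).symm⟩, ?_⟩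
    rw [Finset.sum_empty, nu_zero_smul, Submodule.span_zero_singleton]
    exact bot_le
  | insert i s his ih =>
    refine sup _ _ _ ⟨col h i, .col i, colHom h i x, le_rfl⟩ ih ?_
    rw [Finset.sum_insert his, IsNUModule.add_smul, Submodule.span_singleton_le_iff_mem]
    exact add_mem (Submodule.mem_sup_left ⟨colGen h i, rfl⟩)
      (Submodule.mem_sup_right (Submodule.mem_span_singleton_self _))

theorem FG.exists_finFree (h : LocalUnits e) {N : UMod R} (hN : N.FG) :
    ∃ F, FinFree h F ∧ ∃ p : NUHom R F.carrier N.carrier, Function.Surjective p := by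
  obtain ⟨F, hF, p, hp⟩ := exists_finFree_range h ((fg_iff h N).1 hN)
  exact ⟨F, hF, p, LinearMap.range_eq_top.1 (top_unique hp)⟩

/-- If the modules `R eᵢ` are Noetherian, submodules of finitely generated modules are finitely
generated. -/
theorem FG.left (h : LocalUnits e)
    (hnoeth : ∀ i, IsNoetherian (Unital R) (UMod.col h i).carrier) {A B C : UMod R}
    (hs : SES A B C) (hB : B.FG) : A.FG := by
  obtain ⟨F, hF, q, hq⟩ := hB.exists_finFree h
  obtain ⟨i, p, hi, -, -⟩ := hs
  have := hF.isNoetherian hnoeth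
  have : IsNoetherian (Unital R) B.carrier :=
    isNoetherian_of_surjective (toLin q) (LinearMap.range_eq_top.2 hq)
  have : IsNoetherian (Unital R) A.carrier := isNoetherian_of_injective (toLin i) hi
  exact (fg_iff h A).2 (IsNoetherian.noetherian _)

/-- The first step of a resolution by finitely generated projective modules. -/
theorem FG.exists_syzygy (h : LocalUnits e)
    (hnoeth : ∀ i, IsNoetherian (Unital R) (UMod.col h i).carrier) {N : UMod R} (hN : N.FG) :
    ∃ Q F, SES Q F N ∧ FinFree h F ∧ Q.FG := by
  obtain ⟨F, hF, p, hp⟩ := hN.exists_finFree h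
  have := hF.isNoetherian hnoeth
  have hs := ker_ses h p hp
  have hFfg : F.FG := (fg_iff h F).2 (IsNoetherian.noetherian _)
  exact ⟨_, F, hs, hF, hFfg.left h hnoeth hs⟩

/-! ### Projective dimension along exact assignments -/

variable {S : Type u} [NonUnitalRing S] {J : Type*} {f : J → S}

/-- The part of being an exact functor that matters for projective dimensions: short exact
sequences, retracts and zero modules are preserved. -/
structure ExactAssignment (Φ : UMod R → UMod S) : Prop where
  ses : ∀ {A B C : UMod R}, SES A B C → SES (Φ A) (Φ B) (Φ C)
  retract : ∀ {A B : UMod R}, Retract A B → Retract (Φ A) (Φ B)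
  subsingleton : ∀ N : UMod R, Subsingleton N.carrier → Subsingleton (Φ N).carrier

variable {Φ : UMod R → UMod S}

theorem ExactAssignment.pdle_finFree (hΦ : ExactAssignment Φ) (h : LocalUnits e)
    (h' : LocalUnits f) {d : ℕ} (hd : ∀ i, PDLE d (Φ (col h i))) {F : UMod R}
    (hF : FinFree h F) : PDLE d (Φ F) := by
  induction hF with
  | zero =>
    have := hΦ.subsingleton (zeroMod R) inferInstance
    exact pdle_of_subsingleton h' _ _
  | col i => exact hd i
  | prod A B _ _ hA hB => exact PDLE.mid (hΦ.ses (prod_ses A B)) hA hB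

theorem ExactAssignment.exists_pdle_finFree (hΦ : ExactAssignment Φ) (h : LocalUnits e)
    (h' : LocalUnits f) (hd : ∀ i, ∃ d, PDLE d (Φ (col h i))) {F : UMod R}
    (hF : FinFree h F) : ∃ d, PDLE d (Φ F) := by
  induction hF with
  | zero =>
    have := hΦ.subsingleton (zeroMod R) inferInstance
    exact ⟨0, pdle_of_subsingleton h' _ _⟩
  | col i => exact hd i
  | prod A B _ _ hA hB =>
    obtain ⟨a, hA⟩ := hA
    obtain ⟨b, hB⟩ := hB
    exact ⟨max a b, PDLE.mid (hΦ.ses (prod_ses A B)) (hA.mono (le_max_left _ _))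
      (hB.mono (le_max_right _ _))⟩

/-- A projective finitely generated module is a retract of a finite sum of modules `R eᵢ`. -/
theorem FG.exists_retract (h : LocalUnits e) {N : UMod R} (hN : N.FG) (hpd : PDLE 0 N) :
    ∃ F, FinFree h F ∧ Retract N F := by
  obtain ⟨F, hF, p, hp⟩ := hN.exists_finFree h
  exact ⟨F, hF, ((pdle_zero_iff h N).1 hpd).retract p hp⟩

/-- Induction along a resolution by finite sums of modules `R eᵢ`: a common bound for the
projective dimensions of the images of the `R eᵢ` is added to the projective dimension. -/
theorem ExactAssignment.pdle (hΦ : ExactAssignment Φ) (h : LocalUnits e) (h' : LocalUnits f)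
    (hnoeth : ∀ i, IsNoetherian (Unital R) (UMod.col h i).carrier) {d : ℕ}
    (hd : ∀ i, PDLE d (Φ (col h i))) {n : ℕ} {N : UMod R} (hN : N.FG) (hpd : PDLE n N) :
    PDLE (n + d) (Φ N) := by
  induction n generalizing N with
  | zero =>
    obtain ⟨F, hF, hr⟩ := hN.exists_retract h hpd
    exact (PDLE.retract (hΦ.retract hr) (hΦ.pdle_finFree h h' hd hF)).mono (by omega)
  | succ n ih =>
    obtain ⟨Q, F, hs, hF, hQ⟩ := hN.exists_syzygy h hnoeth
    have := PDLE.right (hΦ.ses hs) (ih hQ (PDLE.left hs (hF.pdle.mono (Nat.zero_le n)) hpd))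
      ((hΦ.pdle_finFree h h' hd hF).mono (by omega))
    exact this.mono (by omega)

/-- Without a common bound for the images of the `R eᵢ`, finiteness is still preserved, since a
finitely generated module involves finitely many of them in each step of its resolution. -/
theorem ExactAssignment.exists_pdle (hΦ : ExactAssignment Φ) (h : LocalUnits e)
    (h' : LocalUnits f) (hnoeth : ∀ i, IsNoetherian (Unital R) (UMod.col h i).carrier)
    (hd : ∀ i, ∃ d, PDLE d (Φ (col h i))) {n : ℕ} {N : UMod R} (hN : N.FG) (hpd : PDLE n N) :
    ∃ d, PDLE d (Φ N) := by
  induction n generalizing N with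
  | zero =>
    obtain ⟨F, hF, hr⟩ := hN.exists_retract h hpd
    obtain ⟨d, hd⟩ := hΦ.exists_pdle_finFree h h' hd hF
    exact ⟨d, PDLE.retract (hΦ.retract hr) hd⟩
  | succ n ih =>
    obtain ⟨Q, F, hs, hF, hQ⟩ := hN.exists_syzygy h hnoeth
    obtain ⟨a, ha⟩ := ih hQ (PDLE.left hs (hF.pdle.mono (Nat.zero_le n)) hpd)
    obtain ⟨b, hb⟩ := hΦ.exists_pdle_finFree h h' hd hF
    exact ⟨max a b + 1, PDLE.right (hΦ.ses hs) (ha.mono (le_max_left a b))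
      (hb.mono (by omega))⟩

/-! ### Noetherian columns -/

/-- If `R eᵢ` is a finite sum of Noetherian `K`-modules `eⱼ R eᵢ`, then it is a Noetherian module.
Its submodules are `K`-submodules: `k x = (k r) x` if `x = r x`. -/
theorem isNoetherian_col {K : Type*} [CommRing K] [Module K R] [IsScalarTower K R R]
    [SMulCommClass K R R] (h : LocalUnits e) (i : I)
    (hfin : {j | ∃ r : R, e j * r * e i ≠ 0}.Finite)
    (hc : ∀ j, IsNoetherian K (corner (M := R) K (e j) (e i))) :
    IsNoetherian (Unital R) (col h i).carrier := by
  let W : Submodule K R := ⨆ j : hfin.toFinset, corner (M := R) K (e j) (e i)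
  have : IsNoetherian K W := isNoetherian_iSup
  have hW : ∀ x : (col h i).carrier, x.1 ∈ W := by
    intro x
    obtain ⟨s, hs⟩ := h.left x.1
    rw [← hs, Finset.sum_mul]
    refine sum_mem fun j _ => ?_
    by_cases hj : j ∈ hfin.toFinset
    · refine (le_iSup (fun j : hfin.toFinset => corner (M := R) K (e j) (e i)) ⟨j, hj⟩) ?_
      refine ⟨x.1, ?_⟩
      change e j * x.1 = e j * (x.1 * e i)
      rw [col_mul]
    · have : e j * x.1 = 0 := by
        rw [← col_mul h i x, ← mul_assoc]
        by_contra hne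
        exact hj (hfin.mem_toFinset.2 ⟨x.1, hne⟩)
      rw [this]
      exact zero_mem _
  let φ (N : Submodule (Unital R) (col h i).carrier) : Submodule K W :=
    { carrier := {w | ∃ x ∈ N, x.1 = w.1}
      zero_mem' := ⟨0, N.zero_mem, rfl⟩
      add_mem' := by
        rintro a b ⟨x, hx, hxa⟩ ⟨y, hy, hyb⟩
        exact ⟨x + y, N.add_mem hx hy, congrArg₂ (· + ·) hxa hyb⟩
      smul_mem' := by
        rintro k w ⟨x, hx, hxw⟩
        obtain ⟨r, hr⟩ := h.exists_smul_eq (col h i).unitary x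
        refine ⟨(k • r) • x, ?_, ?_⟩
        · rw [← of_smul]
          exact N.smul_mem _ hx
        · change (k • r) * x.1 = k • w.1
          rw [smul_mul_assoc, ← hxw]
          exact congrArg (k • ·) (congrArg Subtype.val hr) }
  have hmono : StrictMono φ := by
    refine Monotone.strictMono_of_injective ?_ ?_
    · rintro N N' hle w ⟨x, hx, hxw⟩
      exact ⟨x, hle hx, hxw⟩
    · have hle : ∀ N N', φ N = φ N' → N ≤ N' := by
        intro N N' heq x hx
        have : (⟨x.1, hW x⟩ : W) ∈ φ N' := heq ▸ ⟨x, hx, rfl⟩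
        obtain ⟨y, hy, hyx⟩ := this
        rwa [Subtype.ext hyx] at hy
      exact fun N N' heq => le_antisymm (hle N N' heq) (hle N' N heq.symm)
  rw [isNoetherian_iff']
  exact hmono.wellFoundedGT

end UMod

theorem LocalUnits.exists_common {R I : Type*} [NonUnitalRing R] {e : I → R} (h : LocalUnits e)
    (a b : R) : ∃ c : R, c * a = a ∧ c * b = b := by
  classical
  obtain ⟨s, hs⟩ := h.left a
  obtain ⟨t, ht⟩ := h.left b
  exact ⟨_, fix_mono (N := R) h.idem h.orth Finset.subset_union_left (t := s ∪ t) hs,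
    fix_mono (N := R) h.idem h.orth Finset.subset_union_right (t := s ∪ t) ht⟩

namespace UMod

variable {R S : Type u} [NonUnitalRing R] [NonUnitalRing S] {J : Type*} {f : J → S}

/-! ### Restriction along a ring homomorphism -/

/-- The largest unitary `S`-submodule of an `R`-module, for a ring homomorphism `S → R`: the
elements that are fixed by some element of `S`. -/
def resSub (h : LocalUnits f) (ι : S →ₙ+* R) (N : UMod R) : AddSubgroup N.carrier where
  carrier := {x | ∃ s : S, ι s • x = x}
  zero_mem' := ⟨0, nu_smul_zero _⟩
  add_mem' := by
    rintro x y ⟨s, hs⟩ ⟨t, ht⟩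
    obtain ⟨c, hcs, hct⟩ := h.exists_common s t
    refine ⟨c, ?_⟩
    rw [IsNUModule.smul_add, ← hs, ← ht, ← IsNUModule.mul_smul, ← IsNUModule.mul_smul, ← map_mul,
      ← map_mul, hcs, hct]
  neg_mem' := by
    rintro x ⟨s, hs⟩
    exact ⟨s, by rw [nu_smul_neg, hs]⟩

theorem smul_mem_resSub (h : LocalUnits f) (ι : S →ₙ+* R) (N : UMod R) (s : S) (x : N.carrier) :
    ι s • x ∈ resSub h ι N := by
  obtain ⟨c, hc⟩ := h.exists_smul_eq h.isUnitary s
  exact ⟨c, by rw [← IsNUModule.mul_smul, ← map_mul]; exact congrArg (ι · • x) hc⟩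

instance (h : LocalUnits f) (ι : S →ₙ+* R) (N : UMod R) : SMul S (resSub h ι N) :=
  ⟨fun s x => ⟨ι s • x.1, smul_mem_resSub h ι N s x⟩⟩

instance (h : LocalUnits f) (ι : S →ₙ+* R) (N : UMod R) : IsNUModule S (resSub h ι N) where
  smul_add r x y := Subtype.ext (IsNUModule.smul_add (ι r) x.1 y.1)
  add_smul r s x := Subtype.ext <| by
    change ι (r + s) • x.1 = ι r • x.1 + ι s • x.1
    rw [map_add, IsNUModule.add_smul]
  mul_smul r s x := Subtype.ext <| by
    change ι (r * s) • x.1 = ι r • ι s • x.1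
    rw [map_mul, IsNUModule.mul_smul]

/-- The restriction of a unitary module along a ring homomorphism `ι : S → R` that need not map
local units to local units: the unitary `S`-module `ι(S) N`. -/
def res (h : LocalUnits f) (ι : S →ₙ+* R) (N : UMod R) : UMod S where
  carrier := resSub h ι N
  unitary := LocalUnits.isUnitary_of_fix fun x => x.2.imp fun _ hs => Subtype.ext hs

/-- The inclusion of the restriction. -/
def resVal {h : LocalUnits f} {ι : S →ₙ+* R} {N : UMod R} : (res h ι N).carrier →+ N.carrier :=
  (resSub h ι N).subtype

theorem resVal_injective {h : LocalUnits f} {ι : S →ₙ+* R} {N : UMod R} :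
    Function.Injective (resVal (h := h) (ι := ι) (N := N)) := Subtype.val_injective

theorem resVal_smul {h : LocalUnits f} {ι : S →ₙ+* R} {N : UMod R} (s : S)
    (x : (res h ι N).carrier) : resVal (s • x) = ι s • resVal x := rfl

theorem exists_smul_resVal {h : LocalUnits f} {ι : S →ₙ+* R} {N : UMod R}
    (x : (res h ι N).carrier) : ∃ s : S, ι s • resVal x = resVal x := x.2

/-- Homomorphisms into the restriction. -/
def resLift {h : LocalUnits f} {ι : S →ₙ+* R} {N : UMod R} {A : UMod S}
    (g : A.carrier →+ N.carrier) (hg : ∀ (s : S) x, g (s • x) = ι s • g x) :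
    NUHom S A.carrier (res h ι N).carrier where
  toAddMonoidHom := g.codRestrict (resSub h ι N) fun x => by
    obtain ⟨s, hs⟩ := h.exists_smul_eq A.unitary x
    exact ⟨s, by rw [← hg, hs]⟩
  map_smul' s x := Subtype.ext (hg s x)

/-- The action of restriction on homomorphisms. -/
def resMap (h : LocalUnits f) (ι : S →ₙ+* R) {A B : UMod R} (g : NUHom R A.carrier B.carrier) :
    NUHom S (res h ι A).carrier (res h ι B).carrier :=
  resLift (g.toAddMonoidHom.comp resVal) fun s x => g.map_smul (ι s) (resVal x)

theorem resMap_surjective (h : LocalUnits f) (ι : S →ₙ+* R) {A B : UMod R}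
    (g : NUHom R A.carrier B.carrier) (hg : Function.Surjective g) :
    Function.Surjective (resMap h ι g) := by
  intro y
  obtain ⟨s, hs⟩ := exists_smul_resVal y
  obtain ⟨x, hx⟩ := hg (resVal y)
  refine ⟨⟨ι s • x, smul_mem_resSub h ι A s x⟩, resVal_injective ?_⟩
  change g (ι s • x) = resVal y
  rw [NUHom.map_smul, hx, hs]

theorem exactAssignment_res (h : LocalUnits f) (ι : S →ₙ+* R) :
    ExactAssignment (res h ι : UMod R → UMod S) where
  ses := by
    rintro A B C ⟨i, p, hi, hp, hx⟩
    refine ⟨resMap h ι i, resMap h ι p, ?_, resMap_surjective h ι p hp, fun x => ?_⟩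
    · intro x y hxy
      exact resVal_injective (hi (congrArg resVal hxy))
    · constructor
      · intro hpx
        obtain ⟨y, hy⟩ := (hx (resVal x)).1 (congrArg resVal hpx)
        obtain ⟨s, hs⟩ := exists_smul_resVal x
        refine ⟨⟨ι s • y, smul_mem_resSub h ι A s y⟩, resVal_injective ?_⟩
        change i (ι s • y) = resVal x
        rw [NUHom.map_smul, hy, hs]
      · rintro ⟨y, rfl⟩
        exact resVal_injective ((hx _).2 ⟨resVal y, rfl⟩)
  retract := by
    rintro A B ⟨s, p, hsp⟩
    exact ⟨resMap h ι s, resMap h ι p, fun x => resVal_injective (hsp (resVal x))⟩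
  subsingleton := fun N _ => resVal_injective.subsingleton

/-! ### Inflation along a surjective ring homomorphism -/

/-- A copy of `N`, on which `R` acts through `π : R → S`. -/
def Inflated (_π : R →ₙ+* S) (N : UMod S) : Type u := N.carrier

instance (π : R →ₙ+* S) (N : UMod S) : AddCommGroup (Inflated π N) :=
  inferInstanceAs (AddCommGroup N.carrier)

instance (π : R →ₙ+* S) (N : UMod S) : SMul R (Inflated π N) :=
  ⟨fun r x => (π r • (show N.carrier from x) : N.carrier)⟩

instance (π : R →ₙ+* S) (N : UMod S) : IsNUModule R (Inflated π N) where
  smul_add r x y := IsNUModule.smul_add (N := N.carrier) (π r) x y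
  add_smul r s x := (congrArg (fun a => (a • (show N.carrier from x) : N.carrier))
    (map_add π r s)).trans (IsNUModule.add_smul _ _ _)
  mul_smul r s x := (congrArg (fun a => (a • (show N.carrier from x) : N.carrier))
    (map_mul π r s)).trans (IsNUModule.mul_smul _ _ _)

/-- The inflation of an `S`-module to an `R`-module along a surjective ring homomorphism
`R → S`. -/
def infl (π : R →ₙ+* S) (hπ : Function.Surjective π) (N : UMod S) : UMod R where
  carrier := Inflated π N
  unitary := fun x => by
    refine AddSubgroup.closure_mono ?_ (N.unitary x)
    rintro _ ⟨⟨s, y⟩, rfl⟩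
    obtain ⟨r, rfl⟩ := hπ s
    exact ⟨(r, y), rfl⟩

variable {π : R →ₙ+* S} {hπ : Function.Surjective π}

/-- The identity map between a module and its inflation. -/
def inflVal {N : UMod S} : (infl π hπ N).carrier ≃+ N.carrier := AddEquiv.refl N.carrier

/-- The action of inflation on homomorphisms. -/
def inflMap (π : R →ₙ+* S) (hπ : Function.Surjective π) {A B : UMod S}
    (g : NUHom S A.carrier B.carrier) :
    NUHom R (infl π hπ A).carrier (infl π hπ B).carrier where
  toAddMonoidHom := g.toAddMonoidHom
  map_smul' r x := g.map_smul (π r) x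

/-- Homomorphisms between inflations are homomorphisms over the quotient ring. -/
def deflMap {A B : UMod S} (g : NUHom R (infl π hπ A).carrier (infl π hπ B).carrier) :
    NUHom S A.carrier B.carrier where
  toAddMonoidHom := g.toAddMonoidHom
  map_smul' s x := by
    obtain ⟨r, rfl⟩ := hπ s
    exact g.map_smul r x

theorem exactAssignment_infl (π : R →ₙ+* S) (hπ : Function.Surjective π) :
    ExactAssignment (infl π hπ : UMod S → UMod R) where
  ses := by
    rintro A B C ⟨i, p, hi, hp, hx⟩
    exact ⟨inflMap π hπ i, inflMap π hπ p, hi, hp, hx⟩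
  retract := by
    rintro A B ⟨s, p, hsp⟩
    exact ⟨inflMap π hπ s, inflMap π hπ p, hsp⟩
  subsingleton := fun _ hN => hN

theorem fg_infl_iff (N : UMod S) : (infl π hπ N).FG ↔ N.FG := by
  have hset : ∀ s : Finset N.carrier,
      {y : N.carrier | ∃ r : R, ∃ a ∈ s, y = π r • a} = {y | ∃ r : S, ∃ a ∈ s, y = r • a} := by
    intro s
    ext y
    constructor
    · rintro ⟨r, a, ha, rfl⟩
      exact ⟨π r, a, ha, rfl⟩
    · rintro ⟨r, a, ha, rfl⟩
      obtain ⟨r, rfl⟩ := hπ r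
      exact ⟨r, a, ha, rfl⟩
  constructor
  · rintro ⟨s, hs⟩
    exact ⟨s, fun x => hset s ▸ hs x⟩
  · rintro ⟨s, hs⟩
    refine ⟨s, fun x => ?_⟩
    have := hs x
    rw [← hset s] at this
    exact this

theorem IsProjective.of_infl {N : UMod S} (hN : (infl π hπ N).IsProjective) : N.IsProjective := by
  intro A B g k hg
  obtain ⟨l, hl⟩ := hN _ _ (inflMap π hπ g) (inflMap π hπ k) hg
  exact ⟨deflMap l, hl⟩

/-- If inflation preserves projectives, then it does not lower projective dimensions. -/
theorem PDLE.of_infl {I : Type*} {e : I → R} (h : LocalUnits e) (h' : LocalUnits f)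
    (hproj : ∀ P : UMod S, P.IsProjective → (infl π hπ P).IsProjective) {n : ℕ} {N : UMod S}
    (hN : PDLE n (infl π hπ N)) : PDLE n N := by
  induction n generalizing N with
  | zero => exact (pdle_zero_iff h' N).2 ((pdle_zero_iff h _).1 hN).of_infl
  | succ n ih =>
    obtain ⟨p, hp⟩ := exists_cover h' N
    have := module_projective_cover h' N
    have hP := isProjective_of_module_projective (cover h' N)
    have hs := ker_ses h' p hp
    refine PDLE.right hs (ih ?_) (((pdle_zero_iff h' _).2 hP).mono (Nat.zero_le _))
    exact PDLE.left ((exactAssignment_infl π hπ).ses hs)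
      (((pdle_zero_iff h _).2 (hproj _ hP)).mono (Nat.zero_le _)) hN

/-- An exact assignment that preserves projectives does not raise projective dimensions. -/
theorem ExactAssignment.pdle_of_projective {I : Type*} {e : I → R} (h : LocalUnits e)
    (h' : LocalUnits f) {Φ : UMod R → UMod S} (hΦ : ExactAssignment Φ)
    (hproj : ∀ P : UMod R, P.IsProjective → (Φ P).IsProjective) {n : ℕ} {N : UMod R}
    (hN : PDLE n N) : PDLE n (Φ N) := by
  induction n generalizing N with
  | zero => exact (pdle_zero_iff h' _).2 (hproj _ ((pdle_zero_iff h _).1 hN))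
  | succ n ih =>
    obtain ⟨p, hp⟩ := exists_cover h N
    have := module_projective_cover h N
    have hP := isProjective_of_module_projective (cover h N)
    have hs := ker_ses h p hp
    have hQ := PDLE.left hs (((pdle_zero_iff h _).2 hP).mono (Nat.zero_le n)) hN
    exact PDLE.right (hΦ.ses hs) (ih hQ)
      (((pdle_zero_iff h' _).2 (hproj _ hP)).mono (Nat.zero_le _))

/-! ### Isomorphism invariance and extensions -/

theorem FG.mid {I : Type*} {e : I → R} (h : LocalUnits e) {A B C : UMod R} (hs : SES A B C)
    (hA : A.FG) (hC : C.FG) : B.FG := by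
  obtain ⟨i, p, -, hp, hx⟩ := hs
  rw [fg_iff h] at hA hC ⊢
  refine Submodule.fg_of_fg_map_of_fg_inf_ker (toLin p) ?_ ?_
  · rwa [Submodule.map_top, LinearMap.range_eq_top.2 hp]
  · have hker : LinearMap.ker (toLin p) = (⊤ : Submodule (Unital R) A.carrier).map (toLin i) := by
      rw [Submodule.map_top]
      exact Submodule.ext hx
    rw [top_inf_eq, hker]
    exact hA.map _

theorem pdle_congr {A B : UMod R} (g : NUHom R A.carrier B.carrier) (hg : Function.Bijective g)
    (n : ℕ) : PDLE n A ↔ PDLE n B :=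
  ⟨PDLE.retract (Retract.of_bijective' g hg), PDLE.retract (Retract.of_bijective g hg)⟩

theorem finPD_congr {I : Type*} {e : I → R} (h : LocalUnits e) {A B : UMod R}
    (g : NUHom R A.carrier B.carrier) (hg : Function.Bijective g) : A.FinPD ↔ B.FinPD := by
  unfold FinPD
  rw [pd_lt_top_iff h, pd_lt_top_iff h, exists_congr (pdle_congr g hg)]
  refine and_congr_left fun _ => ⟨fun hA => hA.of_surjective h g hg.2, fun hB =>
    hB.of_surjective h (g.inverse hg) fun x => ⟨g x, g.inverse_apply hg x⟩⟩

end UMod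

open UMod

namespace Tri

section idempotents

variable {T M U : Type*} [NonUnitalRing U] [NonUnitalRing T] [AddCommGroup M]
  [SMul U M] [IsNUModule U M] [SMul Tᵐᵒᵖ M] [IsNUModule Tᵐᵒᵖ M] [SMulCommClass U Tᵐᵒᵖ M]

/-! ### The triangular matrix algebra and its diagonal -/

/-- The inclusion of `T`. -/
def inT : T →ₙ+* Tri T M U where
  toFun t := ⟨t, 0, 0⟩
  map_zero' := rfl
  map_add' _ _ := by ext <;> simp
  map_mul' _ _ := by ext <;> simp [nu_smul_zero]

/-- The inclusion of `U`. -/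
def inU : U →ₙ+* Tri T M U where
  toFun u := ⟨0, 0, u⟩
  map_zero' := rfl
  map_add' _ _ := by ext <;> simp
  map_mul' _ _ := by ext <;> simp [nu_smul_zero]

/-- The inclusion of `M`. -/
def inM : M →+ Tri T M U where
  toFun m := ⟨0, m, 0⟩
  map_zero' := rfl
  map_add' _ _ := by ext <;> simp

/-- The projection to `T`. -/
def prT : Tri T M U →ₙ+* T where
  toFun := Tri.t
  map_zero' := rfl
  map_add' _ _ := rfl
  map_mul' _ _ := rfl

/-- The projection to `U`. -/
def prU : Tri T M U →ₙ+* U where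
  toFun := Tri.u
  map_zero' := rfl
  map_add' _ _ := rfl
  map_mul' _ _ := rfl

@[simp] theorem inT_t (t : T) : (inT t : Tri T M U).t = t := rfl
@[simp] theorem inT_m (t : T) : (inT t : Tri T M U).m = 0 := rfl
@[simp] theorem inT_u (t : T) : (inT t : Tri T M U).u = 0 := rfl
@[simp] theorem inM_t (m : M) : (inM m : Tri T M U).t = 0 := rfl
@[simp] theorem inM_m (m : M) : (inM m : Tri T M U).m = m := rfl
@[simp] theorem inM_u (m : M) : (inM m : Tri T M U).u = 0 := rfl
@[simp] theorem inU_t (u : U) : (inU u : Tri T M U).t = 0 := rfl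
@[simp] theorem inU_m (u : U) : (inU u : Tri T M U).m = 0 := rfl
@[simp] theorem inU_u (u : U) : (inU u : Tri T M U).u = u := rfl

theorem prT_surjective : Function.Surjective (prT (T := T) (M := M) (U := U)) :=
  fun t => ⟨inT t, rfl⟩

theorem prU_surjective : Function.Surjective (prU (T := T) (M := M) (U := U)) :=
  fun u => ⟨inU u, rfl⟩

theorem mul_inU (a : Tri T M U) (u : U) : a * inU u = inU (a.u * u) := by
  ext <;> simp [nu_smul_zero, nu_zero_smul]

theorem mul_inT (a : Tri T M U) (t : T) :
    a * inT t = inT (a.t * t) + inM (MulOpposite.op t • a.m) := by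
  ext <;> simp [nu_smul_zero]

theorem inU_mul_inM (u : U) (m : M) : (inU u * inM m : Tri T M U) = inM (u • m) := by
  ext <;> simp [nu_zero_smul]

theorem inT_mul_inU (t : T) (u : U) : (inT t * inU u : Tri T M U) = 0 := by
  ext <;> simp [nu_zero_smul]

theorem inU_mul_inT (t : T) (u : U) : (inU u * inT t : Tri T M U) = 0 := by
  ext <;> simp [nu_smul_zero]

theorem mk_zero (t : T) (u : U) : (⟨t, 0, u⟩ : Tri T M U) = inT t + inU u := by
  ext <;> simp

variable {I J : Type*} {e : I → U} {f : J → T}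

theorem sum_idem (s : Finset I) (t : Finset J) :
    ∑ a ∈ s.disjSum t, idem M e f a = ⟨∑ j ∈ t, f j, 0, ∑ i ∈ s, e i⟩ := by
  have h1 : ∑ i ∈ s, idem M e f (Sum.inl i) = inU (∑ i ∈ s, e i) := (map_sum inU _ _).symm
  have h2 : ∑ j ∈ t, idem M e f (Sum.inr j) = inT (∑ j ∈ t, f j) := (map_sum inT _ _).symm
  rw [Finset.sum_disjSum, h1, h2, add_comm, ← mk_zero]

theorem localUnits_op (h : LocalUnits f) : LocalUnits fun j => MulOpposite.op (f j) where
  idem j := by rw [← MulOpposite.op_mul, h.idem]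
  orth i j hij := by rw [← MulOpposite.op_mul, h.orth j i hij.symm, MulOpposite.op_zero]
  left r := (h.right r.unop).imp fun s hs => by
    rw [← Finset.op_sum]
    exact congrArg MulOpposite.op hs
  right r := (h.left r.unop).imp fun s hs => by
    rw [← Finset.op_sum]
    exact congrArg MulOpposite.op hs

theorem localUnits_idem (hU : LocalUnits e) (hT : LocalUnits f) (hUM : IsUnitary U M)
    (hTM : IsUnitary Tᵐᵒᵖ M) : LocalUnits (idem M e f) where
  idem a := by
    rcases a with i | j
    · ext <;> simp [idem, hU.idem, nu_smul_zero]
    · ext <;> simp [idem, hT.idem, nu_smul_zero]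
  orth a b hab := by
    rcases a with i | j <;> rcases b with i' | j'
    · ext <;> simp [idem, nu_smul_zero, hU.orth i i' fun h => hab (h ▸ rfl)]
    · ext <;> simp [idem, nu_smul_zero]
    · ext <;> simp [idem, nu_smul_zero]
    · ext <;> simp [idem, nu_smul_zero, hT.orth j j' fun h => hab (h ▸ rfl)]
  left r := by
    classical
    obtain ⟨t, ht⟩ := hT.left r.t
    obtain ⟨s, hs⟩ := hU.exists_fix hUM r.m
    obtain ⟨s', hs'⟩ := hU.left r.u
    refine ⟨(s ∪ s').disjSum t, ?_⟩
    rw [sum_idem]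
    ext
    · exact ht
    · rw [mul_m, nu_smul_zero, zero_add]
      exact LocalUnits.fix_mono hU.idem hU.orth Finset.subset_union_left hs
    · exact LocalUnits.fix_mono (N := U) hU.idem hU.orth Finset.subset_union_right hs'
  right r := by
    classical
    obtain ⟨t, ht⟩ := hT.right r.t
    have hop := localUnits_op hT
    obtain ⟨t', ht'⟩ := hop.exists_fix hTM r.m
    obtain ⟨s, hs⟩ := hU.right r.u
    refine ⟨s.disjSum (t ∪ t'), ?_⟩
    rw [sum_idem]
    ext
    · change r.t * ∑ j ∈ t ∪ t', f j = r.t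
      rw [← ht, mul_assoc,
        (LocalUnits.sum_mul_sum hT.idem hT.orth Finset.subset_union_left).2]
    · rw [mul_m, nu_smul_zero, add_zero, Finset.op_sum]
      exact LocalUnits.fix_mono hop.idem hop.orth Finset.subset_union_right ht'
    · exact hs

/-! ### Noetherian columns of the triangular matrix algebra -/

variable {K : Type*} [CommRing K] [Module K U] [IsScalarTower K U U] [SMulCommClass K U U]
  [Module K T] [IsScalarTower K T T] [SMulCommClass K T T]
  [Module K M] [IsScalarTower K U M] [SMulCommClass K U M]
  [IsScalarTower K Tᵐᵒᵖ M] [SMulCommClass K Tᵐᵒᵖ M]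

/-- The Peirce pieces of the triangular matrix algebra are those of `U`, `M` and `T`, and zero. -/
theorem isNoetherian_corner_idem
    (hU : ∀ i i', IsNoetherian K (corner (M := U) K (e i) (e i')))
    (hT : ∀ j j', IsNoetherian K (corner (M := T) K (f j) (f j')))
    (hM : ∀ i j, IsNoetherian K (corner (M := M) K (e i) (f j))) (a b : I ⊕ J) :
    IsNoetherian K (corner (M := Tri T M U) K (idem M e f a) (idem M e f b)) := by
  let lU : U →ₗ[K] Tri T M U :=
    { toFun := inU, map_add' := map_add inU, map_smul' := fun k u => by ext <;> simp }
  let lT : T →ₗ[K] Tri T M U :=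
    { toFun := inT, map_add' := map_add inT, map_smul' := fun k u => by ext <;> simp }
  let lM : M →ₗ[K] Tri T M U :=
    { toFun := inM, map_add' := map_add inM, map_smul' := fun k u => by ext <;> simp }
  have key : ∀ r : Tri T M U, idem M e f a • (MulOpposite.op (idem M e f b) • r)
      = idem M e f a * (r * idem M e f b) := fun r => rfl
  rcases a with i | j <;> rcases b with i' | j'
  · have := hU i i'
    refine isNoetherian_of_le (t := (corner (M := U) K (e i) (e i')).map lU) ?_
    rintro _ ⟨r, rfl⟩
    refine ⟨_, ⟨r.u, rfl⟩, ?_⟩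
    rw [key]
    change inU (e i * (r.u * e i')) = inU (e i) * (r * inU (e i'))
    rw [mul_inU, map_mul]
  · have := hM i j'
    refine isNoetherian_of_le (t := (corner (M := M) K (e i) (f j')).map lM) ?_
    rintro _ ⟨r, rfl⟩
    refine ⟨_, ⟨r.m, rfl⟩, ?_⟩
    rw [key]
    change inM (e i • (MulOpposite.op (f j') • r.m)) = inU (e i) * (r * inT (f j'))
    rw [mul_inT, mul_add, inU_mul_inT, zero_add, inU_mul_inM]
  · refine isNoetherian_of_le (t := (⊥ : Submodule K (Tri T M U))) ?_
    rintro _ ⟨r, rfl⟩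
    rw [key]
    change inT (f j) * (r * inU (e i')) = 0
    rw [mul_inU, inT_mul_inU]
  · have := hT j j'
    refine isNoetherian_of_le (t := (corner (M := T) K (f j) (f j')).map lT) ?_
    rintro _ ⟨r, rfl⟩
    refine ⟨_, ⟨r.t, rfl⟩, ?_⟩
    rw [key]
    change inT (f j * (r.t * f j')) = inT (f j) * (r * inT (f j'))
    rw [mul_inT, mul_add, map_mul]
    have : (inT (f j) * inM (MulOpposite.op (f j') • r.m) : Tri T M U) = 0 := by
      ext <;> simp [nu_smul_zero, nu_zero_smul]
    rw [this, add_zero]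

theorem finite_support_T (h : SupportFinite (idem M e f)) (j : J) :
    {j' | ∃ r : T, f j' * r * f j ≠ 0}.Finite := by
  refine ((h (Sum.inr j)).1.preimage Sum.inr_injective.injOn).subset ?_
  rintro j' ⟨r, hr⟩
  refine ⟨inT r, fun h0 => hr (congrArg Tri.t h0)⟩

end idempotents

section modules

variable {T M U : Type u} [NonUnitalRing U] [NonUnitalRing T] [AddCommGroup M]
  [SMul U M] [IsNUModule U M] [SMul Tᵐᵒᵖ M] [IsNUModule Tᵐᵒᵖ M] [SMulCommClass U Tᵐᵒᵖ M]
  {I J : Type*} {e : I → U} {f : J → T}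

/-! ### The two parts of a module over the triangular matrix algebra -/

/-- The `T`-part of a module over the triangular matrix algebra; for `(Y, φ, X)` it is `Y`. -/
abbrev partT (hT : LocalUnits f) (N : UMod (Tri T M U)) : UMod T := res hT inT N

/-- The `U`-part of a module over the triangular matrix algebra; for `(Y, φ, X)` it is `X`. -/
abbrev partU (hU : LocalUnits e) (N : UMod (Tri T M U)) : UMod U := res hU inU N

/-- The module `(Y, 0, 0)`. -/
abbrev inflT (M : Type u) (U : Type u) [NonUnitalRing U] [AddCommGroup M]
    [SMul U M] [IsNUModule U M] [SMul Tᵐᵒᵖ M] [IsNUModule Tᵐᵒᵖ M] [SMulCommClass U Tᵐᵒᵖ M]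
    (Y : UMod T) : UMod (Tri T M U) := infl prT prT_surjective Y

/-- The module `(0, 0, X)`. -/
abbrev inflU (T : Type u) (M : Type u) [NonUnitalRing T] [AddCommGroup M]
    [SMul U M] [IsNUModule U M] [SMul Tᵐᵒᵖ M] [IsNUModule Tᵐᵒᵖ M] [SMulCommClass U Tᵐᵒᵖ M]
    (X : UMod U) : UMod (Tri T M U) := infl prU prU_surjective X

theorem smul_partU {hU : LocalUnits e} {N : UMod (Tri T M U)} (a : Tri T M U)
    (x : (partU hU N).carrier) :
    a • resVal x = (inU a.u : Tri T M U) • resVal x := by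
  obtain ⟨u, hu⟩ := exists_smul_resVal x
  rw [← hu, ← IsNUModule.mul_smul, ← IsNUModule.mul_smul, mul_inU, map_mul]

theorem inT_smul_partU {hU : LocalUnits e} {N : UMod (Tri T M U)} (t : T)
    (x : (partU hU N).carrier) : (inT t : Tri T M U) • resVal x = 0 := by
  obtain ⟨u, hu⟩ := exists_smul_resVal x
  rw [← hu, ← IsNUModule.mul_smul, inT_mul_inU, nu_zero_smul]

theorem inM_smul_mem_partU (hU : LocalUnits e) (hUM : IsUnitary U M) {N : UMod (Tri T M U)}
    (m : M) (x : N.carrier) :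
    ∃ y : (partU hU N).carrier, resVal y = (inM m : Tri T M U) • x := by
  obtain ⟨u, hu⟩ := hU.exists_smul_eq hUM m
  refine ⟨⟨_, smul_mem_resSub hU inU N u ((inM m : Tri T M U) • x)⟩, ?_⟩
  change (inU u : Tri T M U) • (inM m : Tri T M U) • x = _
  rw [← IsNUModule.mul_smul, inU_mul_inM, hu]

theorem exists_decomp (hU : LocalUnits e) (hT : LocalUnits f) (hUM : IsUnitary U M)
    (hTM : IsUnitary Tᵐᵒᵖ M) (N : UMod (Tri T M U)) (n : N.carrier) :
    ∃ (y : (partT hT N).carrier) (x : (partU hU N).carrier), n = resVal y + resVal x := by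
  classical
  obtain ⟨s, hs⟩ := (localUnits_idem hU hT hUM hTM).exists_fix N.unitary n
  rw [← Finset.toLeft_disjSum_toRight (u := s), sum_idem] at hs
  refine ⟨⟨_, smul_mem_resSub hT inT N (∑ j ∈ s.toRight, f j) n⟩,
    ⟨_, smul_mem_resSub hU inU N (∑ i ∈ s.toLeft, e i) n⟩, ?_⟩
  change n = (inT _ : Tri T M U) • n + (inU _ : Tri T M U) • n
  rw [← IsNUModule.add_smul, ← mk_zero, hs]

theorem decomp_unique {hU : LocalUnits e} {hT : LocalUnits f} {N : UMod (Tri T M U)}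
    {y y' : (partT hT N).carrier} {x x' : (partU hU N).carrier}
    (h : resVal y + resVal x = resVal y' + resVal x') : y = y' := by
  obtain ⟨t, ht⟩ := exists_smul_resVal (y - y')
  have h1 : resVal (y - y') = resVal (x' - x) := by
    rw [map_sub, map_sub, sub_eq_sub_iff_add_eq_add, h, add_comm]
  rw [h1, inT_smul_partU, ← h1] at ht
  exact sub_eq_zero.1 (resVal_injective (ht.symm.trans (map_zero _).symm))

/-- The projection of a module to its `T`-part is linear. -/
theorem exists_projection (hU : LocalUnits e) (hT : LocalUnits f) (hUM : IsUnitary U M)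
    (hTM : IsUnitary Tᵐᵒᵖ M) (N : UMod (Tri T M U)) :
    ∃ q : NUHom (Tri T M U) N.carrier (inflT M U (partT hT N)).carrier,
      (∀ y : (partT hT N).carrier, q (resVal y) = inflVal.symm y) ∧
      ∀ n, q n = 0 ↔ ∃ x : (partU hU N).carrier, resVal x = n := by
  choose y x hyx using exists_decomp hU hT hUM hTM N
  have huniq : ∀ (n : N.carrier) (y' : (partT hT N).carrier) (x' : (partU hU N).carrier),
      n = resVal y' + resVal x' → y n = y' := fun n y' x' h =>
    decomp_unique ((hyx n).symm.trans h)
  -- By uniqueness, `n ↦ y n` is additive and linear, although `y` is a choice function.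
  let q : N.carrier →+ (partT hT N).carrier := AddMonoidHom.mk' y fun n n' => by
    refine huniq _ _ (x n + x n') ?_
    rw [map_add, map_add]
    conv_lhs => rw [hyx n, hyx n']
    abel
  refine ⟨⟨inflVal.symm.toAddMonoidHom.comp q, fun a n => ?_⟩, fun y' => ?_, fun n => ?_⟩
  · change y (a • n) = a.t • y n
    obtain ⟨t, ht⟩ := exists_smul_resVal (y n)
    obtain ⟨z, hz⟩ := inM_smul_mem_partU hU hUM (MulOpposite.op t • a.m) (resVal (y n))
    refine huniq _ _ (z + a.u • x n) ?_
    -- `a y` differs from `a.t y` by the action of an element of `M`, which lands in the `U`-part.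
    have h1 : a • resVal (y n) = resVal (a.t • y n) + resVal z := by
      conv_lhs => rw [← ht]
      rw [← IsNUModule.mul_smul, mul_inT, IsNUModule.add_smul, hz, map_mul,
        IsNUModule.mul_smul, ht, resVal_smul]
    conv_lhs => rw [hyx n]
    rw [IsNUModule.smul_add, h1, smul_partU, map_add, resVal_smul, resVal_smul, add_assoc]
  · exact huniq _ y' 0 (by rw [map_zero, add_zero])
  · constructor
    · intro h
      refine ⟨x n, ?_⟩
      have h0 : y n = 0 := h
      conv_rhs => rw [hyx n, h0, map_zero, zero_add]
    · rintro ⟨x', rfl⟩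
      exact huniq _ 0 x' (by rw [map_zero, zero_add])

/-- The sequence `0 → (0, 0, X) → (Y, φ, X) → (Y, 0, 0) → 0`. -/
theorem parts_ses (hU : LocalUnits e) (hT : LocalUnits f) (hUM : IsUnitary U M)
    (hTM : IsUnitary Tᵐᵒᵖ M) (N : UMod (Tri T M U)) :
    SES (inflU T M (partU hU N)) N (inflT M U (partT hT N)) := by
  obtain ⟨q, hq, hker⟩ := exists_projection hU hT hUM hTM N
  let i : NUHom (Tri T M U) (inflU T M (partU hU N)).carrier N.carrier :=
    ⟨resVal.comp inflVal.toAddMonoidHom, fun a x => (smul_partU a (inflVal x)).symm⟩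
  exact ⟨i, q, resVal_injective.comp inflVal.injective, fun y => ⟨resVal (inflVal y), hq _⟩, hker⟩

/-- `X ↦ (0, 0, X)` is left adjoint to taking the `U`-part, which is exact. -/
theorem isProjective_inflU (hU : LocalUnits e) (P : UMod U) (hP : P.IsProjective) :
    (inflU T M P).IsProjective := by
  intro A B g k hg
  let k' : NUHom U P.carrier (partU hU B).carrier :=
    resLift (k.toAddMonoidHom.comp inflVal.symm.toAddMonoidHom) fun s x => k.map_smul (inU s) x
  obtain ⟨l, hl⟩ := hP (partU hU A) (partU hU B) (resMap hU inU g) k'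
    (resMap_surjective hU inU g hg)
  refine ⟨⟨resVal.comp (l.toAddMonoidHom.comp inflVal.toAddMonoidHom), fun a x => ?_⟩,
    fun x => congrArg resVal (hl (inflVal x))⟩
  change resVal (l (a.u • inflVal x)) = a • resVal (l (inflVal x))
  rw [smul_partU, NUHom.map_smul, resVal_smul]

/-- Taking the `T`-part is left adjoint to the exact functor `Y ↦ (Y, 0, 0)`. -/
theorem isProjective_partT (hU : LocalUnits e) (hT : LocalUnits f) (hUM : IsUnitary U M)
    (hTM : IsUnitary Tᵐᵒᵖ M) (P : UMod (Tri T M U)) (hP : P.IsProjective) :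
    (partT hT P).IsProjective := by
  intro A B g k hg
  obtain ⟨q, hq, -⟩ := exists_projection hU hT hUM hTM P
  obtain ⟨l, hl⟩ := hP (inflT M U A) (inflT M U B) (inflMap prT prT_surjective g)
    ((inflMap prT prT_surjective k).comp q) hg
  refine ⟨⟨inflVal.toAddMonoidHom.comp (l.toAddMonoidHom.comp resVal), fun t x => ?_⟩,
    fun x => ?_⟩
  · exact l.map_smul (inT t) (resVal x)
  · refine (hl (resVal x)).trans ?_
    rw [NUHom.comp_apply, hq]
    rfl

theorem pdle_inflU_iff (hU : LocalUnits e) (hT : LocalUnits f) (hUM : IsUnitary U M)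
    (hTM : IsUnitary Tᵐᵒᵖ M) (n : ℕ) (X : UMod U) : PDLE n (inflU T M X) ↔ PDLE n X :=
  have h := localUnits_idem hU hT hUM hTM
  ⟨PDLE.of_infl h hU (isProjective_inflU hU),
    (exactAssignment_infl _ _).pdle_of_projective hU h (isProjective_inflU hU)⟩

theorem pdle_partT (hU : LocalUnits e) (hT : LocalUnits f) (hUM : IsUnitary U M)
    (hTM : IsUnitary Tᵐᵒᵖ M) {n : ℕ} {N : UMod (Tri T M U)} (hN : PDLE n N) :
    PDLE n (partT hT N) :=
  (exactAssignment_res hT inT).pdle_of_projective (localUnits_idem hU hT hUM hTM) hT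
    (isProjective_partT hU hT hUM hTM) hN

theorem partT_fg (hU : LocalUnits e) (hT : LocalUnits f) (hUM : IsUnitary U M)
    (hTM : IsUnitary Tᵐᵒᵖ M) {N : UMod (Tri T M U)} (hN : N.FG) : (partT hT N).FG := by
  obtain ⟨-, q, -, hq, -⟩ := parts_ses hU hT hUM hTM N
  exact (fg_infl_iff _).1 (hN.of_surjective (localUnits_idem hU hT hUM hTM) q hq)

/-! ### The parts of the projective columns -/

/-- The `U`-part of the column at `eᵢ` is `U eᵢ`. -/
theorem pdle_partU_col_inl (h : LocalUnits (idem M e f)) (hU : LocalUnits e) (i : I) :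
    PDLE 0 (partU hU (col h (Sum.inl i))) := by
  let g : NUHom U (col hU i).carrier (partU hU (col h (Sum.inl i))).carrier :=
    resLift (AddMonoidHom.mk' (fun x => (⟨inU x.1, inU x.1, by
      change (inU x.1 * inU (e i) : Tri T M U) = inU x.1
      rw [← map_mul, col_mul]⟩ : rightCorner (Tri T M U) (Tri T M U) (idem M e f (Sum.inl i))))
      fun x y => Subtype.ext (map_add inU x.1 y.1)) fun s x => Subtype.ext (map_mul inU s x.1)
  refine (pdle_congr g ⟨fun x y hxy => ?_, fun z => ?_⟩ 0).1
    ((pdle_zero_iff hU _).2 (isProjective_col hU i))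
  · exact Subtype.ext (congrArg Tri.u (congrArg Subtype.val (congrArg resVal hxy)))
  · obtain ⟨⟨_, r, rfl⟩, hz⟩ := z
    refine ⟨⟨_, r.u, rfl⟩, resVal_injective (Subtype.ext ?_)⟩
    change inU (r.u * e i) = r * inU (e i)
    rw [mul_inU]

/-- The `U`-part of the column at `fⱼ` is `M fⱼ`. -/
theorem pdle_partU_col_inr_iff (h : LocalUnits (idem M e f)) (hU : LocalUnits e)
    (hT : LocalUnits f) (hUM : IsUnitary U M) (j : J) (n : ℕ) :
    PDLE n (partU hU (col h (Sum.inr j))) ↔ PDLE n (colMod hUM (f j)) := by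
  have hfix : ∀ x : rightCorner T M (f j), MulOpposite.op (f j) • x.1 = x.1 := by
    rintro ⟨_, m, rfl⟩
    change MulOpposite.op (f j) • MulOpposite.op (f j) • m = MulOpposite.op (f j) • m
    rw [← IsNUModule.mul_smul, ← MulOpposite.op_mul, hT.idem]
  let g : NUHom U (colMod hUM (f j)).carrier (partU hU (col h (Sum.inr j))).carrier :=
    resLift (AddMonoidHom.mk' (fun x : rightCorner T M (f j) => (⟨inM x.1, inM x.1, by
      change (inM x.1 * inT (f j) : Tri T M U) = inM x.1
      rw [mul_inT]
      change inT (0 * f j) + inM (MulOpposite.op (f j) • x.1) = inM x.1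
      rw [hfix, zero_mul, map_zero, zero_add]⟩ :
        rightCorner (Tri T M U) (Tri T M U) (idem M e f (Sum.inr j))))
      fun x y => Subtype.ext (map_add inM x.1 y.1))
      fun s x => Subtype.ext (inU_mul_inM s x.1).symm
  refine (pdle_congr g ⟨fun x y hxy => ?_, fun z => ?_⟩ n).symm
  · exact Subtype.ext (congrArg Tri.m (congrArg Subtype.val (congrArg resVal hxy)))
  · obtain ⟨u, hu⟩ := exists_smul_resVal z
    obtain ⟨⟨z, r, hr⟩, hz⟩ := z
    have hu' : inU u * z = z := congrArg Subtype.val hu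
    have hr' : r * inT (f j) = z := hr
    refine ⟨⟨_, r.m, rfl⟩, resVal_injective (Subtype.ext ?_)⟩
    change inM (MulOpposite.op (f j) • r.m) = z
    rw [← hr'] at hu' ⊢
    rw [mul_inT] at hu' ⊢
    ext
    · have := congrArg Tri.t hu'
      simpa using this
    · simp [nu_smul_zero]
    · simp

/-- The `T`-part of the column at `fⱼ` is `T fⱼ`. -/
theorem retract_partT_col (h : LocalUnits (idem M e f)) (hT : LocalUnits f) (j : J) :
    Retract (col hT j) (partT hT (col h (Sum.inr j))) := by
  let g : NUHom T (col hT j).carrier (partT hT (col h (Sum.inr j))).carrier :=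
    resLift (AddMonoidHom.mk' (fun x => (⟨inT x.1, inT x.1, by
      change (inT x.1 * inT (f j) : Tri T M U) = inT x.1
      rw [← map_mul, col_mul]⟩ : rightCorner (Tri T M U) (Tri T M U) (idem M e f (Sum.inr j))))
      fun x y => Subtype.ext (map_add inT x.1 y.1)) fun s x => Subtype.ext (map_mul inT s x.1)
  refine Retract.of_bijective g ⟨fun x y hxy => ?_, fun z => ?_⟩
  · exact Subtype.ext (congrArg Tri.t (congrArg Subtype.val (congrArg resVal hxy)))
  · obtain ⟨t, ht⟩ := exists_smul_resVal z
    obtain ⟨⟨z, r, hr⟩, hz⟩ := z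
    have ht' : inT t * z = z := congrArg Subtype.val ht
    have hr' : r * inT (f j) = z := hr
    refine ⟨⟨_, r.t, rfl⟩, resVal_injective (Subtype.ext ?_)⟩
    change inT (r.t * f j) = z
    rw [← hr'] at ht' ⊢
    rw [mul_inT] at ht' ⊢
    ext
    · simp
    · have := congrArg Tri.m ht'
      simpa [nu_zero_smul, nu_smul_zero] using this
    · simp

/-- The column at `fⱼ` is an extension of `(T fⱼ, 0, 0)` by `(0, 0, M fⱼ)`. -/
theorem pdle_inflT_col (hU : LocalUnits e) (hT : LocalUnits f) (hUM : IsUnitary U M)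
    (hTM : IsUnitary Tᵐᵒᵖ M) (j : J) {d : ℕ} (hd : PDLE d (colMod hUM (f j))) :
    PDLE (d + 1) (inflT M U (col hT j)) := by
  have h := localUnits_idem hU hT hUM hTM
  refine PDLE.retract ((exactAssignment_infl _ _).retract (retract_partT_col h hT j)) ?_
  refine PDLE.right (parts_ses hU hT hUM hTM (col h (Sum.inr j))) ?_
    (((pdle_zero_iff h _).2 (isProjective_col h _)).mono (Nat.zero_le _))
  rw [pdle_inflU_iff hU hT hUM hTM, pdle_partU_col_inr_iff h hU hT hUM]
  exact hd

end modules

end Tri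

open UMod Tri

section comparison

variable {T M U : Type u} [NonUnitalRing U] [NonUnitalRing T] [AddCommGroup M]
  [SMul U M] [IsNUModule U M] [SMul Tᵐᵒᵖ M] [IsNUModule Tᵐᵒᵖ M] [SMulCommClass U Tᵐᵒᵖ M]
  {I J : Type*} {e : I → U} {f : J → T}

/-! ### The parts of a triple -/

/-- The isomorphism of `X` with the `U`-part of `(Y, φ, X)`. -/
def Triple.toPartU (hU : LocalUnits e) (L : Triple T M U) :
    NUHom U L.X.carrier (partU hU L.toUMod).carrier :=
  resLift (N := L.toUMod) (AddMonoidHom.mk' (fun x => (⟨0, x⟩ : L.Col)) fun x x' =>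
    Triple.Col.ext (add_zero 0).symm rfl) fun u x =>
    Triple.Col.ext (nu_smul_zero (0 : T)).symm <| by
      change u • x = L.φ (BalTensor.tmul T (0 : M) 0) + u • x
      rw [L.φ_zero_tmul, zero_add]

theorem Triple.toPartU_bijective (hU : LocalUnits e) (L : Triple T M U) :
    Function.Bijective (L.toPartU hU) := by
  refine ⟨fun x x' h => congrArg Triple.Col.x (congrArg resVal h), fun z => ?_⟩
  obtain ⟨u, hu⟩ := exists_smul_resVal z
  refine ⟨Triple.Col.x (resVal z), resVal_injective (Triple.Col.ext ?_ rfl)⟩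
  have hy : (0 : T) • Triple.Col.y (L := L) (resVal z) = Triple.Col.y (resVal z) :=
    congrArg Triple.Col.y hu
  exact (nu_zero_smul _).symm.trans hy

/-- The isomorphism of `Y` with the `T`-part of `(Y, φ, X)`. -/
def Triple.toPartT (hT : LocalUnits f) (L : Triple T M U) :
    NUHom T L.Y.carrier (partT hT L.toUMod).carrier :=
  resLift (N := L.toUMod) (AddMonoidHom.mk' (fun y => (⟨y, 0⟩ : L.Col)) fun y y' =>
    Triple.Col.ext rfl (add_zero 0).symm) fun t y => Triple.Col.ext rfl <| by
      change 0 = L.φ (BalTensor.tmul T (0 : M) y) + (0 : U) • (0 : L.X.carrier)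
      rw [L.φ_zero_tmul, nu_zero_smul, add_zero]

theorem Triple.toPartT_bijective (hT : LocalUnits f) (L : Triple T M U) :
    Function.Bijective (L.toPartT hT) := by
  refine ⟨fun y y' h => congrArg Triple.Col.y (congrArg resVal h), fun z => ?_⟩
  obtain ⟨t, ht⟩ := exists_smul_resVal z
  refine ⟨Triple.Col.y (resVal z), resVal_injective (Triple.Col.ext rfl ?_)⟩
  have hx : L.φ (BalTensor.tmul T (0 : M) (Triple.Col.y (resVal z)))
      + (0 : U) • Triple.Col.x (L := L) (resVal z) = Triple.Col.x (resVal z) :=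
    congrArg Triple.Col.x ht
  rw [L.φ_zero_tmul, nu_zero_smul, add_zero] at hx
  exact hx

/-! ### Comparison of projective dimensions -/

/-- `(0, 0, X)` is a submodule of `N`, and the columns are Noetherian. -/
theorem partU_fg (hU : LocalUnits e) (hT : LocalUnits f) (hUM : IsUnitary U M)
    (hTM : IsUnitary Tᵐᵒᵖ M)
    (nL : ∀ a, IsNoetherian (Unital (Tri T M U))
      (col (localUnits_idem hU hT hUM hTM) a).carrier)
    {N : UMod (Tri T M U)} (hN : N.FG) : (partU hU N).FG :=
  (fg_infl_iff _).1 (hN.left (localUnits_idem hU hT hUM hTM) nL (parts_ses hU hT hUM hTM N))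

theorem exists_pdle_partU (hU : LocalUnits e) (hT : LocalUnits f) (hUM : IsUnitary U M)
    (hTM : IsUnitary Tᵐᵒᵖ M)
    (nL : ∀ a, IsNoetherian (Unital (Tri T M U))
      (col (localUnits_idem hU hT hUM hTM) a).carrier)
    (hcol : ∀ j, ∃ d, PDLE d (colMod hUM (f j))) {N : UMod (Tri T M U)}
    (hN : N.FG) {n : ℕ} (hpd : PDLE n N) : ∃ d, PDLE d (partU hU N) := by
  have h := localUnits_idem hU hT hUM hTM
  refine (exactAssignment_res hU inU).exists_pdle h hU nL (fun a => ?_) hN hpd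
  rcases a with i | j
  · exact ⟨0, pdle_partU_col_inl h hU i⟩
  · obtain ⟨d, hd⟩ := hcol j
    exact ⟨d, (pdle_partU_col_inr_iff h hU hT hUM j d).2 hd⟩

/-- A module over the triangular matrix algebra is finitely generated of finite projective dimension
if and only if its two parts are. -/
theorem finPD_iff_parts (hU : LocalUnits e) (hT : LocalUnits f) (hUM : IsUnitary U M)
    (hTM : IsUnitary Tᵐᵒᵖ M)
    (nT : ∀ j, IsNoetherian (Unital T) (col hT j).carrier)
    (nL : ∀ a, IsNoetherian (Unital (Tri T M U))
      (col (localUnits_idem hU hT hUM hTM) a).carrier)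
    (hcol : ∀ j, ∃ d, PDLE d (colMod hUM (f j))) (N : UMod (Tri T M U)) :
    N.FinPD ↔ (partT hT N).FinPD ∧ (partU hU N).FinPD := by
  have h := localUnits_idem hU hT hUM hTM
  have hs := parts_ses hU hT hUM hTM N
  unfold FinPD
  rw [pd_lt_top_iff h, pd_lt_top_iff hT, pd_lt_top_iff hU]
  constructor
  · rintro ⟨hN, n, hn⟩
    exact ⟨⟨partT_fg hU hT hUM hTM hN, n, pdle_partT hU hT hUM hTM hn⟩,
      partU_fg hU hT hUM hTM nL hN, exists_pdle_partU hU hT hUM hTM nL hcol hN hn⟩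
  · rintro ⟨⟨hY, n, hn⟩, hX, k, hk⟩
    obtain ⟨d, hd⟩ := (exactAssignment_infl prT prT_surjective).exists_pdle hT h nT
      (fun j => (hcol j).imp' _ fun _ hd => pdle_inflT_col hU hT hUM hTM j hd) hY hn
    refine ⟨((fg_infl_iff _).2 hX).mid h hs ((fg_infl_iff _).2 hY), max k d, PDLE.mid hs ?_ ?_⟩
    · exact ((pdle_inflU_iff hU hT hUM hTM k _).2 hk).mono (le_max_left _ _)
    · exact hd.mono (le_max_right _ _)

theorem pd_inflT_le (hU : LocalUnits e) (hT : LocalUnits f) (hUM : IsUnitary U M)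
    (hTM : IsUnitary Tᵐᵒᵖ M)
    (nT : ∀ j, IsNoetherian (Unital T) (col hT j).carrier)
    {d : ℕ} (hcol : ∀ j, PDLE d (colMod hUM (f j))) {Y : UMod T} (hY : Y.FG) :
    (inflT M U Y).pd ≤ Y.pd + 1 + d := by
  rcases eq_or_ne Y.pd ⊤ with htop | htop
  · simp [htop]
  · obtain ⟨n, hn⟩ := ENat.ne_top_iff_exists.1 htop
    have h := localUnits_idem hU hT hUM hTM
    have := (exactAssignment_infl prT prT_surjective).pdle hT h nT
      (fun j => pdle_inflT_col hU hT hUM hTM j (hcol j)) hY ((pd_le_iff hT Y n).1 hn.symm.le)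
    rw [← pd_le_iff h] at this
    refine this.trans (le_of_eq ?_)
    rw [← hn]
    push_cast
    rw [add_assoc, add_comm (d : ℕ∞)]

theorem UMod.SES.pd_le {R : Type u} [NonUnitalRing R] {ε : I → R} (h : LocalUnits ε)
    {A B C : UMod R} (hs : SES A B C) : B.pd ≤ max A.pd C.pd := by
  rcases eq_or_ne (max A.pd C.pd) ⊤ with htop | htop
  · exact htop ▸ le_top
  · obtain ⟨n, hn⟩ := ENat.ne_top_iff_exists.1 htop
    rw [← hn]
    exact (pd_le_iff h B n).2 (PDLE.mid hs ((pd_le_iff h A n).1 (hn ▸ le_max_left _ _))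
      ((pd_le_iff h C n).1 (hn ▸ le_max_right _ _)))

theorem pd_le_of_pdle_imp {R S : Type u} [NonUnitalRing R] [NonUnitalRing S] {ε : I → R}
    {η : J → S} (h : LocalUnits ε) (h' : LocalUnits η) {A : UMod R} {B : UMod S}
    (hAB : ∀ n, PDLE n A → PDLE n B) : B.pd ≤ A.pd := by
  refine sInf_le_sInf fun d => ?_
  rintro ⟨n, rfl, hn⟩
  exact ⟨n, rfl, (hasProjRes_iff h' n B).2 (hAB n ((hasProjRes_iff h n A).1 hn))⟩

/-- `Y` is the `T`-part of `(Y, 0, 0)`. -/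
theorem pd_le_pd_inflT (hU : LocalUnits e) (hT : LocalUnits f) (hUM : IsUnitary U M)
    (hTM : IsUnitary Tᵐᵒᵖ M)
    (Y : UMod T) : Y.pd ≤ (inflT M U Y).pd := by
  let g : NUHom T Y.carrier (partT hT (inflT M U Y)).carrier :=
    resLift (N := inflT M U Y) inflVal.symm.toAddMonoidHom fun t y => rfl
  have hg : Function.Bijective g :=
    ⟨fun y y' hy => congrArg resVal hy, fun z => ⟨inflVal (resVal z), rfl⟩⟩
  exact pd_le_of_pdle_imp (localUnits_idem hU hT hUM hTM) hT fun n hn =>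
    (pdle_congr g hg n).2 (pdle_partT hU hT hUM hTM hn)

theorem pd_inflU (hU : LocalUnits e) (hT : LocalUnits f) (hUM : IsUnitary U M)
    (hTM : IsUnitary Tᵐᵒᵖ M)
    (X : UMod U) : (inflU T M X).pd = X.pd :=
  le_antisymm
    (pd_le_of_pdle_imp hU (localUnits_idem hU hT hUM hTM) fun n =>
      (pdle_inflU_iff hU hT hUM hTM n X).2)
    (pd_le_of_pdle_imp (localUnits_idem hU hT hUM hTM) hU fun n =>
      (pdle_inflU_iff hU hT hUM hTM n X).1)

theorem pd_le_max_parts (hU : LocalUnits e) (hT : LocalUnits f) (hUM : IsUnitary U M)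
    (hTM : IsUnitary Tᵐᵒᵖ M)
    (nT : ∀ j, IsNoetherian (Unital T) (col hT j).carrier)
    {d : ℕ} (hcol : ∀ j, PDLE d (colMod hUM (f j))) {N : UMod (Tri T M U)}
    (hN : N.FG) : N.pd ≤ max (partU hU N).pd ((partT hT N).pd + 1 + d) := by
  refine (SES.pd_le (localUnits_idem hU hT hUM hTM) (parts_ses hU hT hUM hTM N)).trans ?_
  rw [pd_inflU hU hT hUM hTM]
  exact max_le_max le_rfl
    (pd_inflT_le hU hT hUM hTM nT hcol (partT_fg hU hT hUM hTM hN))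

/-! ### Comparison of the dimensions of the rings -/

theorem glDim_bounds (hU : LocalUnits e) (hT : LocalUnits f) (hUM : IsUnitary U M)
    (hTM : IsUnitary Tᵐᵒᵖ M)
    (nT : ∀ j, IsNoetherian (Unital T) (col hT j).carrier)
    (nL : ∀ a, IsNoetherian (Unital (Tri T M U))
      (col (localUnits_idem hU hT hUM hTM) a).carrier)
    {d : ℕ} (hcol : ∀ j, PDLE d (colMod hUM (f j))) :
    (glDim U ≤ glDim (Tri T M U) ∧ glDim T ≤ glDim (Tri T M U)) ∧
      glDim (Tri T M U) ≤ max (glDim U) (glDim T + 1 + d) := by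
  refine ⟨⟨iSup₂_le fun X hX => ?_, iSup₂_le fun Y hY => ?_⟩, iSup₂_le fun N hN => ?_⟩
  · exact (pd_inflU hU hT hUM hTM X).ge.trans
      (le_iSup₂ (f := fun (N : UMod (Tri T M U)) (_ : N.FG) => N.pd) _ ((fg_infl_iff X).2 hX))
  · exact (pd_le_pd_inflT hU hT hUM hTM Y).trans
      (le_iSup₂ (f := fun (N : UMod (Tri T M U)) (_ : N.FG) => N.pd) _ ((fg_infl_iff Y).2 hY))
  · have hX : (partU hU N).pd ≤ glDim U :=
      le_iSup₂ (f := fun (X : UMod U) (_ : X.FG) => X.pd) _ (partU_fg hU hT hUM hTM nL hN)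
    have hY : (partT hT N).pd ≤ glDim T :=
      le_iSup₂ (f := fun (Y : UMod T) (_ : Y.FG) => Y.pd) _ (partT_fg hU hT hUM hTM hN)
    exact (pd_le_max_parts hU hT hUM hTM nT hcol hN).trans
      (max_le_max hX (add_le_add_left (add_le_add_left hY 1) _))

theorem finDim_bounds (hU : LocalUnits e) (hT : LocalUnits f) (hUM : IsUnitary U M)
    (hTM : IsUnitary Tᵐᵒᵖ M)
    (nT : ∀ j, IsNoetherian (Unital T) (col hT j).carrier)
    (nL : ∀ a, IsNoetherian (Unital (Tri T M U))
      (col (localUnits_idem hU hT hUM hTM) a).carrier)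
    {d : ℕ} (hcol : ∀ j, PDLE d (colMod hUM (f j))) :
    (finDim U ≤ finDim (Tri T M U) ∧ finDim T ≤ finDim (Tri T M U)) ∧
      finDim (Tri T M U) ≤ max (finDim U) (finDim T + 1 + d) := by
  refine ⟨⟨iSup₂_le fun X hX => ?_, iSup₂_le fun Y hY => ?_⟩, iSup₂_le fun N hN => ?_⟩
  · exact (pd_inflU hU hT hUM hTM X).ge.trans
      (le_iSup₂ (f := fun (N : UMod (Tri T M U)) (_ : N.FinPD) => N.pd) _
        ⟨(fg_infl_iff X).2 hX.1, (pd_inflU hU hT hUM hTM X).trans_lt hX.2⟩)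
  · refine (pd_le_pd_inflT hU hT hUM hTM Y).trans
      (le_iSup₂ (f := fun (N : UMod (Tri T M U)) (_ : N.FinPD) => N.pd) _
        ⟨(fg_infl_iff Y).2 hY.1, (pd_inflT_le hU hT hUM hTM nT hcol hY.1).trans_lt ?_⟩)
    exact ENat.add_lt_top.2 ⟨ENat.add_lt_top.2 ⟨hY.2, ENat.natCast_lt_top 1⟩,
      ENat.natCast_lt_top d⟩
  · have hparts := (finPD_iff_parts hU hT hUM hTM nT nL (fun j => ⟨d, hcol j⟩) N).1 hN
    have hX : (partU hU N).pd ≤ finDim U :=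
      le_iSup₂ (f := fun (X : UMod U) (_ : X.FinPD) => X.pd) _ hparts.2
    have hY : (partT hT N).pd ≤ finDim T :=
      le_iSup₂ (f := fun (Y : UMod T) (_ : Y.FinPD) => Y.pd) _ hparts.1
    exact (pd_le_max_parts hU hT hUM hTM nT hcol hN.1).trans
      (max_le_max hX (add_le_add_left (add_le_add_left hY 1) _))

end comparison

end TriAlg

open TriAlg in
theorem theorem4p11 {K : Type w} [CommRing K]
    {U T M : Type u}
    -- `U` and `T` are `K`-algebras
    [NonUnitalRing U] [Module K U] [IsScalarTower K U U] [SMulCommClass K U U]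
    [NonUnitalRing T] [Module K T] [IsScalarTower K T T] [SMulCommClass K T T]
    -- `M` is a unitary `U`-`T`-bimodule on which `K` acts centrally
    [AddCommGroup M] [Module K M]
    [SMul U M] [IsNUModule U M] [IsScalarTower K U M] [SMulCommClass K U M]
    [SMul Tᵐᵒᵖ M] [IsNUModule Tᵐᵒᵖ M] [IsScalarTower K Tᵐᵒᵖ M] [SMulCommClass K Tᵐᵒᵖ M]
    [SMulCommClass U Tᵐᵒᵖ M]
    (hUM : IsUnitary U M) (hTM : IsUnitary Tᵐᵒᵖ M)
    {I J : Type*} (e : I → U) (f : J → T)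
    (hU : IsBasicWEI K e) (hT : IsBasicWEI K f)
    (hM : ∀ i j, IsFiniteLength K (corner (M := M) K (e i) (f j)))
    (hsupp : SupportFinite (Tri.idem M e f)) :
    ((∀ j, (colMod hUM (f j)).pd < ⊤) →
      ∀ L : Triple T M U, L.toUMod.FinPD ↔ L.Y.FinPD ∧ L.X.FinPD) ∧
    (∀ m : ℕ∞, m = ⨆ j, (colMod hUM (f j)).pd → m < ⊤ →
      (max (glDim U - m) (glDim T) ≤ glDim (Tri T M U) ∧
        glDim (Tri T M U) ≤ max (glDim U) (glDim T + 1 + m)) ∧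
      (max (finDim U - m) (finDim T) ≤ finDim (Tri T M U) ∧
        finDim (Tri T M U) ≤ max (finDim U) (finDim T + 1 + m))) := by
  have hU' := LocalUnits.ofIsWEI hU.toIsWEI
  have hT' := LocalUnits.ofIsWEI hT.toIsWEI
  have h := Tri.localUnits_idem hU' hT' hUM hTM
  have cU := fun i i' => (isFiniteLength_iff_isNoetherian_isArtinian.1 (hU.homFinite i' i)).1
  have cT := fun j j' => (isFiniteLength_iff_isNoetherian_isArtinian.1 (hT.homFinite j' j)).1
  have cM := fun i j => (isFiniteLength_iff_isNoetherian_isArtinian.1 (hM i j)).1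
  have nT : ∀ j, IsNoetherian (Unital T) (UMod.col hT' j).carrier := fun j =>
    UMod.isNoetherian_col (K := K) hT' j (Tri.finite_support_T hsupp j) fun j' => cT j' j
  have nL : ∀ a, IsNoetherian (Unital (Tri T M U)) (UMod.col h a).carrier := fun a =>
    UMod.isNoetherian_col (K := K) h a (hsupp a).1 fun b =>
      Tri.isNoetherian_corner_idem cU cT cM b a
  refine ⟨fun hcol L => ?_, fun m hm hmtop => ?_⟩
  · rw [finPD_iff_parts hU' hT' hUM hTM nT nL fun j => (UMod.pd_lt_top_iff hU' _).1 (hcol j),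
      UMod.finPD_congr hT' (L.toPartT hT') (L.toPartT_bijective hT'),
      UMod.finPD_congr hU' (L.toPartU hU') (L.toPartU_bijective hU')]
  obtain ⟨d, rfl⟩ := ENat.ne_top_iff_exists.1 hmtop.ne
  have hcol : ∀ j, UMod.PDLE d (colMod hUM (f j)) := fun j =>
    (UMod.pd_le_iff hU' _ d).1 (hm ▸ le_iSup (fun j => (colMod hUM (f j)).pd) j)
  obtain ⟨⟨gU, gT⟩, gL⟩ := glDim_bounds hU' hT' hUM hTM nT nL hcol
  obtain ⟨⟨fU, fT⟩, fL⟩ := finDim_bounds hU' hT' hUM hTM nT nL hcol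
  exact ⟨⟨max_le (tsub_le_self.trans gU) gT, gL⟩, max_le (tsub_le_self.trans fU) fT, fL⟩
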